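/- Let $H^m_{per}([0,1])$ denote the space of 1-periodic functions on $\mathbb{R}$ whose weak derivatives up to order $m$ are square integrable over a period, and let $E(f)=\int_0^1\big((f^3+f)_{hh}\big)^2\,dh$. Let $u_0\in H^2_{per}([0,1])$ with $u_0\ge 0$ and $L:=\int_0^1\frac{1}{u_0}\,dh<\infty$. Let $u$ be a global positive strong solution, with initial datum $u_0$, of $$u_t=-u^2(u^3+u)_{hhhh},$$ that is, for every $T>0$: $u$ is positive on $[0,T]\times\mathbb{R}$ (where $u(t,\cdot)$ is represented by its continuous representative), $u\in C([0,T];H^2_{per}([0,1]))\cap L^2([0,T];H^4_{per}([0,1]))$, $u_t\in L^2([0,T];L^2_{per}([0,1]))$, $u(0,\cdot)=u_0$, and the equation holds for a.e. $(t,h)\in[0,T]\times[0,1]$. Put $u_{\min}=\inf_{[0,\infty)\times[0,1]}u$, $\beta=2u_{\min}^2+6u_{\min}^4$ and $E_0=E(u_0)$. Then $u_{\min}\ge m$ for a constant $m>0$ depending only on $u_0$; in particular $\beta>0$. The energy decays exponentially: $$E(u(t,\cdot))\le E_0\,e^{-\beta t}\quad\text{for all } t\ge 0.$$ Moreover, with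 $u^*=1/L$, $$\|u(t,\cdot)-u^*\|_{L^\infty([0,1])}\to 0\quad\text{as } t\to\infty.$$ -/

import Mathlib

open MeasureTheory Set Filter Topology
open scoped ContDiff ENNReal

namespace VicinalSurface

/-- `g` is the weak (distributional) derivative of order `k` on `ℝ` of the locally integrable
function `f`. -/
def IsWeakDeriv (k : ℕ) (f g : ℝ → ℝ) : Prop :=
  LocallyIntegrable f volume ∧ LocallyIntegrable g volume ∧
    ∀ φ : ℝ → ℝ, ContDiff ℝ ∞ φ → HasCompactSupport φ →
      ∫ h, f h * iteratedDeriv k φ h = (-1) ^ k * ∫ h, g h * φ h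

open Classical in
/-- A representative of the weak derivative of order `k` of `f` (unique up to null sets);
the value is `0` if `f` has no weak derivative of order `k`. -/
noncomputable def weakDeriv (k : ℕ) (f : ℝ → ℝ) : ℝ → ℝ :=
  if hf : ∃ g, IsWeakDeriv k f g then Classical.choose hf else 0

/-- Lebesgue measure on the period cell `[0,1]`. -/
noncomputable def cell : Measure ℝ := volume.restrict (Icc (0 : ℝ) 1)

/-- `f` belongs to the periodic Sobolev space `H^m_per([0,1])`: it is 1-periodic and its weak
derivatives up to order `m` exist and are square integrable over a period. -/
def MemHper (m : ℕ) (f : ℝ → ℝ) : Prop :=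
  (∀ᵐ h, f (h + 1) = f h) ∧
    ∀ k ≤ m, ∃ g, IsWeakDeriv k f g ∧ MemLp g 2 cell

/-- The square of the `H^m([0,1])` norm. -/
noncomputable def sobolevNormSq (m : ℕ) (f : ℝ → ℝ) : ℝ≥0∞ :=
  ∑ k ∈ Finset.range (m + 1), eLpNorm (weakDeriv k f) 2 cell ^ 2

/-- The energy `E(f) = ∫₀¹ ((f³ + f)_{hh})² dh`. -/
noncomputable def energy (f : ℝ → ℝ) : ℝ :=
  ∫ h in (0 : ℝ)..1, (weakDeriv 2 (fun x => f x ^ 3 + f x) h) ^ 2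

/-- `w` is the weak time derivative of `u` on `(0,T) × ℝ`. -/
def IsWeakTimeDeriv (T : ℝ) (u w : ℝ → ℝ → ℝ) : Prop :=
  ∀ φ : ℝ × ℝ → ℝ, ContDiff ℝ ∞ φ → HasCompactSupport φ →
    tsupport φ ⊆ Ioo (0 : ℝ) T ×ˢ univ →
    ∫ p : ℝ × ℝ, u p.1 p.2 * deriv (fun s => φ (s, p.2)) p.1 =
      - ∫ p : ℝ × ℝ, w p.1 p.2 * φ p

/-- `u` is a (positive) strong solution on `[0,T]` of `u_t = -u² (u³ + u)_{hhhh}` with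
1-periodic boundary conditions in `h` and initial datum `u₀`. Here `u t` is the (continuous
representative of the) profile at time `t`. -/
structure IsStrongSolution (T : ℝ) (u₀ : ℝ → ℝ) (u : ℝ → ℝ → ℝ) : Prop where
  /-- each profile is represented by its continuous representative -/
  continuous_profile : ∀ t ∈ Icc 0 T, Continuous (u t)
  /-- `u` is positive -/
  pos : ∀ t ∈ Icc 0 T, ∀ h, 0 < u t h
  /-- `u ∈ C([0,T]; H²_per)`: values in `H²_per` -/
  mem_H2 : ∀ t ∈ Icc 0 T, MemHper 2 (u t)
  /-- `u ∈ C([0,T]; H²_per)`: continuity in the `H²` norm -/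
  continuous_H2 : ∀ t₀ ∈ Icc 0 T,
    Tendsto (fun t => sobolevNormSq 2 (fun h => u t h - u t₀ h)) (𝓝[Icc 0 T] t₀) (𝓝 0)
  /-- `u ∈ L²([0,T]; H⁴_per)`: values in `H⁴_per` for almost every time -/
  mem_H4 : ∀ᵐ t ∂(volume.restrict (Icc 0 T)), MemHper 4 (u t)
  /-- `u ∈ L²([0,T]; H⁴_per)`: finiteness of the norm -/
  lintegral_H4 : ∫⁻ t in Icc 0 T, sobolevNormSq 4 (u t) < ⊤
  /-- the initial condition -/
  initial : ∀ᵐ h, u 0 h = u₀ h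
  /-- `u_t` exists weakly, lies in `L²([0,T]; L²_per)`, and the equation holds almost
  everywhere -/
  equation : ∃ w : ℝ → ℝ → ℝ,
    (∀ᵐ t ∂(volume.restrict (Icc 0 T)), ∀ᵐ h, w t (h + 1) = w t h) ∧
    AEStronglyMeasurable (fun p : ℝ × ℝ => w p.1 p.2)
      (volume.restrict (Icc (0 : ℝ) T ×ˢ univ)) ∧
    MemLp (fun p : ℝ × ℝ => w p.1 p.2) 2
      (volume.restrict (Icc (0 : ℝ) T ×ˢ Icc (0 : ℝ) 1)) ∧
    IsWeakTimeDeriv T u w ∧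
    ∀ᵐ t ∂(volume.restrict (Icc 0 T)), ∀ᵐ h,
      w t h = - (u t h) ^ 2 * weakDeriv 4 (fun x => u t x ^ 3 + u t x) h

/-- A global strong solution: a strong solution on `[0,T]` for every `T > 0`. -/
def IsGlobalStrongSolution (u₀ : ℝ → ℝ) (u : ℝ → ℝ → ℝ) : Prop :=
  ∀ T : ℝ, 0 < T → IsStrongSolution T u₀ u

/-- `u_min`, the infimum of `u` over `[0,∞) × [0,1]`. -/
noncomputable def uMin (u : ℝ → ℝ → ℝ) : ℝ :=
  sInf ((fun p : ℝ × ℝ => u p.1 p.2) '' (Ici (0 : ℝ) ×ˢ Icc (0 : ℝ) 1))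

/-- The decay rate `β = 2 u_min² + 6 u_min⁴`. -/
noncomputable def decayRate (u : ℝ → ℝ → ℝ) : ℝ :=
  2 * uMin u ^ 2 + 6 * uMin u ^ 4

end VicinalSurface

/-!
Put `v = u³ + u`. The argument rests on two integrated laws.

* The equation says `(1/u)_t = v_hhhh`, whose mean over a period vanishes, so `∫ 1/u = L` for all
  times.
* Since `v_t = (3u² + 1) u_t = -u²(3u² + 1) v_hhhh`, the energy `E = ∫ v_hh²` satisfies
  `E' = 2 ∫ v_hhhh v_t = -2 ∫ u²(3u² + 1) v_hhhh²`. Poincaré's inequality `∫ v_hh² ≤ ∫ v_hhhh²` and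
  Grönwall's lemma turn a lower bound `b ≤ u` into decay at the rate `2b² + 6b⁴`
  (`IsStrongSolution.conservation_and_decay`).

With `b = 0` the energy is nonincreasing. As `v_h` vanishes somewhere and dominates `u_h`, the slope
of `u` is at most `√E ≤ √E₀`, so `log u` varies by at most `∫ |u_h|/u ≤ √E₀ · L`; since `u` takes the
value `1/L`, it stays above `e^{-√E₀ L}/L` (`lower_bound`). The decay estimate applied once more with
`b = u_min` gives the exponential rate, and `|u - 1/L| ≤ √E` gives the uniform convergence.

What has to be justified is the calculus for weak solutions. In the space variable, functions with
weak derivatives are replaced by iterated primitives (`MemHper.primChain`, from the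
du Bois-Reymond lemma `ae_eq_const_add_integral`), for which products and compositions obey the
usual rules, so that `v` inherits four derivatives from `u`. In time, testing with products
`χ(t) ψ(h)` shows that for almost every `h` the function `t ↦ u(t, h)` is absolutely continuous with
derivative `u_t` (`ae_isPrimOn_time`). The energy identity, where `v_hhhh` and `v_t` are merely
square integrable, is proved for each spatial Fourier mode and summed by Parseval's identity and
dominated convergence (`energy_identity`).
-/

namespace VicinalSurface

/-! ### Absolutely continuous functions as primitives -/

/-- `f` is absolutely continuous between `a` and `b` with derivative `g`: the function `g` is
integrable there and `f` is, up to a constant, its primitive. -/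
def IsPrimOn (a b : ℝ) (f g : ℝ → ℝ) : Prop :=
  IntervalIntegrable g volume a b ∧ ∀ x ∈ uIcc a b, f x - f a = ∫ y in a..x, g y

/-- `f` is locally absolutely continuous on `ℝ` with derivative `g`. -/
def IsPrim (f g : ℝ → ℝ) : Prop := ∀ a b, IsPrimOn a b f g

/-- A function whose increments are controlled by those of an absolutely continuous function is
absolutely continuous. -/
lemma absolutelyContinuousOnInterval_of_dist_le {a b M : ℝ} {f p : ℝ → ℝ}
    (hf : AbsolutelyContinuousOnInterval f a b)
    (h : ∀ x ∈ uIcc a b, ∀ y ∈ uIcc a b, dist (p x) (p y) ≤ M * dist (f x) (f y)) :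
    AbsolutelyContinuousOnInterval p a b := by
  unfold AbsolutelyContinuousOnInterval at hf ⊢
  have h0 := hf.const_mul M
  rw [mul_zero] at h0
  refine squeeze_zero' (Eventually.of_forall fun E => Finset.sum_nonneg fun _ _ => dist_nonneg)
    ?_ h0
  have : ∀ᶠ E in AbsolutelyContinuousOnInterval.totalLengthFilter ⊓
      𝓟 (AbsolutelyContinuousOnInterval.disjWithin a b),
      E ∈ AbsolutelyContinuousOnInterval.disjWithin a b :=
    mem_inf_of_right (mem_principal_self _)
  filter_upwards [this] with E hE
  rw [Finset.mul_sum]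
  refine Finset.sum_le_sum fun i hi => h _ ?_ _ ?_
  · exact (hE.1 i hi).1
  · exact (hE.1 i hi).2

namespace IsPrimOn

variable {a b : ℝ} {f g f₁ g₁ f₂ g₂ : ℝ → ℝ}

lemma absolutelyContinuous (h : IsPrimOn a b f g) : AbsolutelyContinuousOnInterval f a b := by
  refine absolutelyContinuousOnInterval_of_dist_le (M := 1)
    (h.1.absolutelyContinuousOnInterval_intervalIntegral (c := a) left_mem_uIcc) ?_
  intro x hx y hy
  rw [← h.2 x hx, ← h.2 y hy, dist_sub_right, one_mul]

lemma continuousOn (h : IsPrimOn a b f g) : ContinuousOn f (uIcc a b) :=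
  h.absolutelyContinuous.continuousOn

lemma ae_hasDerivAt (h : IsPrimOn a b f g) :
    ∀ᵐ x, x ∈ uIcc a b → HasDerivAt f (g x) x := by
  have e : ∀ c : ℝ, ∀ᵐ x : ℝ, x ≠ c := fun c => by
    simp [ae_iff]
  filter_upwards [h.1.ae_hasDerivAt_integral, e (min a b), e (max a b)] with x hx h1 h2 hxm
  have h3 := (hx hxm a left_mem_uIcc).const_add (f a)
  refine h3.congr_of_eventuallyEq ?_
  have : uIcc a b ∈ 𝓝 x :=
    Icc_mem_nhds (lt_of_le_of_ne hxm.1 (Ne.symm h1)) (lt_of_le_of_ne hxm.2 h2)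
  filter_upwards [this] with y hy
  linarith [h.2 y hy]

lemma of_absolutelyContinuous (hf : AbsolutelyContinuousOnInterval f a b)
    (hg : IntervalIntegrable g volume a b)
    (h : ∀ᵐ x, x ∈ uIcc a b → HasDerivAt f (g x) x) : IsPrimOn a b f g := by
  refine ⟨hg, fun x hx => ?_⟩
  have hsub : uIcc a x ⊆ uIcc a b := uIcc_subset_uIcc left_mem_uIcc hx
  rw [← (hf.mono hsub).integral_deriv_eq_sub]
  refine intervalIntegral.integral_congr_ae ?_
  filter_upwards [h] with y hy hyx
  exact (hy (hsub (uIoc_subset_uIcc hyx))).deriv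

lemma mul (h₁ : IsPrimOn a b f₁ g₁) (h₂ : IsPrimOn a b f₂ g₂) :
    IsPrimOn a b (fun x => f₁ x * f₂ x) (fun x => g₁ x * f₂ x + f₁ x * g₂ x) := by
  refine of_absolutelyContinuous (h₁.absolutelyContinuous.fun_mul h₂.absolutelyContinuous) ?_ ?_
  · exact (h₁.1.mul_continuousOn h₂.continuousOn).add (h₂.1.continuousOn_mul h₁.continuousOn)
  · filter_upwards [h₁.ae_hasDerivAt, h₂.ae_hasDerivAt] with x hx₁ hx₂ hx
    exact (hx₁ hx).mul (hx₂ hx)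

lemma add (h₁ : IsPrimOn a b f₁ g₁) (h₂ : IsPrimOn a b f₂ g₂) :
    IsPrimOn a b (fun x => f₁ x + f₂ x) (fun x => g₁ x + g₂ x) := by
  refine ⟨h₁.1.add h₂.1, fun x hx => ?_⟩
  have hsub : uIcc a x ⊆ uIcc a b := uIcc_subset_uIcc left_mem_uIcc hx
  rw [intervalIntegral.integral_add (h₁.1.mono_set hsub) (h₂.1.mono_set hsub), ← h₁.2 x hx,
    ← h₂.2 x hx]
  ring

lemma const_mul (h : IsPrimOn a b f g) (c : ℝ) :
    IsPrimOn a b (fun x => c * f x) (fun x => c * g x) := by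
  refine ⟨h.1.const_mul c, fun x hx => ?_⟩
  rw [intervalIntegral.integral_const_mul, ← h.2 x hx]
  ring

lemma of_hasDerivAt (h : ∀ x, HasDerivAt f (g x) x) (hg : Continuous g) : IsPrimOn a b f g :=
  ⟨hg.intervalIntegrable _ _, fun x _ => by
    rw [intervalIntegral.integral_eq_sub_of_hasDerivAt (fun y _ => h y)
      (hg.intervalIntegrable _ _)]⟩

/-- Chain rule: composition with a function that is `C¹` on an interval containing the range. -/
lemma comp (h : IsPrimOn a b f g) {φ φ' : ℝ → ℝ} {c d : ℝ}
    (hφ : ∀ y ∈ Icc c d, HasDerivAt φ (φ' y) y) (hφ' : ContinuousOn φ' (Icc c d))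
    (hf : ∀ x ∈ uIcc a b, f x ∈ Icc c d) :
    IsPrimOn a b (fun x => φ (f x)) (fun x => φ' (f x) * g x) := by
  obtain ⟨M, hM⟩ := isCompact_Icc.exists_bound_of_continuousOn hφ'
  refine of_absolutelyContinuous (absolutelyContinuousOnInterval_of_dist_le (M := M)
    h.absolutelyContinuous fun x hx y hy => ?_) ?_ ?_
  · have := (convex_Icc c d).norm_image_sub_le_of_norm_hasDerivWithin_le
      (fun z hz => (hφ z hz).hasDerivWithinAt) hM (hf y hy) (hf x hx)
    simpa [dist_eq_norm] using this
  · exact h.1.continuousOn_mul (hφ'.comp h.continuousOn hf)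
  · filter_upwards [h.ae_hasDerivAt] with x hx hxm
    exact (hφ _ (hf x hxm)).comp x (hx hxm)

lemma congr_right (h : IsPrimOn a b f g) (hg : g =ᵐ[volume] g₁) : IsPrimOn a b f g₁ :=
  ⟨h.1.congr_ae (ae_restrict_of_ae hg), fun x hx => by
    rw [h.2 x hx]
    exact intervalIntegral.integral_congr_ae (hg.mono fun y hy _ => hy)⟩

end IsPrimOn

namespace IsPrim

variable {f g f₁ g₁ f₂ g₂ : ℝ → ℝ}

lemma continuous (h : IsPrim f g) : Continuous f := by
  refine continuous_iff_continuousAt.2 fun x => ?_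
  refine (h (x - 1) (x + 1)).continuousOn.continuousAt ?_
  rw [uIcc_of_le (by linarith)]
  exact Icc_mem_nhds (by linarith) (by linarith)

lemma integral_eq (h : IsPrim f g) (a b : ℝ) : ∫ x in a..b, g x = f b - f a :=
  ((h a b).2 b right_mem_uIcc).symm

lemma locallyIntegrable (h : IsPrim f g) : LocallyIntegrable g volume := by
  intro x
  refine ⟨Icc (x - 1) (x + 1), Icc_mem_nhds (by linarith) (by linarith), ?_⟩
  exact (intervalIntegrable_iff_integrableOn_Icc_of_le (by linarith)).1 (h (x - 1) (x + 1)).1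

lemma mul (h₁ : IsPrim f₁ g₁) (h₂ : IsPrim f₂ g₂) :
    IsPrim (fun x => f₁ x * f₂ x) (fun x => g₁ x * f₂ x + f₁ x * g₂ x) :=
  fun a b => (h₁ a b).mul (h₂ a b)

lemma add (h₁ : IsPrim f₁ g₁) (h₂ : IsPrim f₂ g₂) :
    IsPrim (fun x => f₁ x + f₂ x) (fun x => g₁ x + g₂ x) :=
  fun a b => (h₁ a b).add (h₂ a b)

lemma of_hasDerivAt (h : ∀ x, HasDerivAt f (g x) x) (hg : Continuous g) : IsPrim f g :=
  fun _ _ => IsPrimOn.of_hasDerivAt h hg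

lemma hasDerivAt (h : IsPrim f g) (hg : Continuous g) (x : ℝ) : HasDerivAt f (g x) x := by
  have h1 := (hg.integral_hasStrictDerivAt 0 x).hasDerivAt.const_add (f 0)
  refine h1.congr_of_eventuallyEq (Eventually.of_forall fun y => ?_)
  simp only [h.integral_eq 0 y]
  ring

lemma periodic (h : IsPrim f g) (hg : Continuous g) (hf : Function.Periodic f 1) :
    Function.Periodic g 1 := by
  intro x
  have h1 : HasDerivAt (fun y => f (y + 1)) (g (x + 1)) x :=
    (h.hasDerivAt hg (x + 1)).comp_add_const x 1
  have h2 : (fun y => f (y + 1)) = f := funext hf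
  rw [h2] at h1
  exact h1.unique (h.hasDerivAt hg x)

end IsPrim

/-! ### Weak derivatives on the line -/

lemma IsWeakDeriv.ae_eq {k : ℕ} {f g g' : ℝ → ℝ} (h : IsWeakDeriv k f g)
    (h' : IsWeakDeriv k f g') : g =ᵐ[volume] g' := by
  refine ae_eq_of_integral_contDiff_smul_eq h.2.1 h'.2.1 fun φ hφ hc => ?_
  have h1 := (h.2.2 φ hφ hc).symm.trans (h'.2.2 φ hφ hc)
  have h2 := mul_left_cancel₀ (pow_ne_zero k (by norm_num : (-1 : ℝ) ≠ 0)) h1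
  simpa [mul_comm] using h2

lemma IsWeakDeriv.isWeakDeriv_weakDeriv {k : ℕ} {f g : ℝ → ℝ} (h : IsWeakDeriv k f g) :
    IsWeakDeriv k f (weakDeriv k f) := by
  have he : ∃ g, IsWeakDeriv k f g := ⟨g, h⟩
  rw [weakDeriv, dif_pos he]
  exact Classical.choose_spec he

lemma IsWeakDeriv.weakDeriv_ae_eq {k : ℕ} {f g : ℝ → ℝ} (h : IsWeakDeriv k f g) :
    weakDeriv k f =ᵐ[volume] g :=
  h.isWeakDeriv_weakDeriv.ae_eq h

lemma isWeakDeriv_congr {k : ℕ} {f f' g : ℝ → ℝ} (h : f =ᵐ[volume] f') :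
    IsWeakDeriv k f g ↔ IsWeakDeriv k f' g := by
  have key : ∀ {f f' : ℝ → ℝ}, f =ᵐ[volume] f' → IsWeakDeriv k f g → IsWeakDeriv k f' g := by
    intro f f' h hw
    refine ⟨hw.1.congr h, hw.2.1, fun φ hφ hc => ?_⟩
    rw [← hw.2.2 φ hφ hc]
    exact integral_congr_ae (h.mono fun x hx => by simp only [hx])
  exact ⟨key h, key h.symm⟩

open Classical in
lemma weakDeriv_congr {k : ℕ} {f f' : ℝ → ℝ} (h : f =ᵐ[volume] f') :
    weakDeriv k f = weakDeriv k f' := by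
  have : IsWeakDeriv k f = IsWeakDeriv k f' := funext fun g => propext (isWeakDeriv_congr h)
  exact congrArg (fun P : (ℝ → ℝ) → Prop =>
    if hf : ∃ g, P g then Classical.choose hf else 0) this

/-- Consecutive weak derivatives of the same function are weak derivatives of each other. -/
lemma IsWeakDeriv.step {k : ℕ} {f g g' : ℝ → ℝ} (h : IsWeakDeriv k f g)
    (h' : IsWeakDeriv (k + 1) f g') : IsWeakDeriv 1 g g' := by
  refine ⟨h.2.1, h'.2.1, fun φ hφ hc => ?_⟩
  have h1 := h.2.2 (deriv φ) (by fun_prop) hc.deriv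
  have h2 := h'.2.2 φ hφ hc
  rw [iteratedDeriv_succ'] at h2
  rw [h2, pow_succ, mul_assoc] at h1
  have h3 := mul_left_cancel₀ (pow_ne_zero k (by norm_num : (-1 : ℝ) ≠ 0)) h1
  rw [iteratedDeriv_one, ← h3, pow_one]

/-- Integration by parts against a function vanishing outside a bounded interval. -/
lemma IsPrimOn.integral_mul_deriv {a b : ℝ} (hab : a ≤ b) {f g φ : ℝ → ℝ} (h : IsPrimOn a b f g)
    (hφ : ContDiff ℝ ∞ φ) (hs : tsupport φ ⊆ Ioo a b) :
    ∫ x, f x * deriv φ x = -∫ x, g x * φ x := by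
  have hd : Continuous (deriv φ) := hφ.continuous_deriv (by norm_num)
  have hφp : IsPrimOn a b φ (deriv φ) :=
    IsPrimOn.of_hasDerivAt (fun x => (hφ.differentiable (by norm_num) x).hasDerivAt) hd
  have hz : ∀ x, x ∉ Ioo a b → φ x = 0 := fun x hx => image_eq_zero_of_notMem_tsupport
    fun h => hx (hs h)
  have hz' : ∀ x, x ∉ Ioo a b → deriv φ x = 0 := fun x hx =>
    image_eq_zero_of_notMem_tsupport fun h => hx (hs (tsupport_deriv_subset (𝕜 := ℝ) h))
  have key := ((h.mul hφp).2 b right_mem_uIcc).symm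
  simp only at key
  rw [hz a (by simp), hz b (by simp), mul_zero, mul_zero, sub_zero,
    intervalIntegral.integral_add (h.1.mul_continuousOn hφ.continuous.continuousOn)
    ((hd.intervalIntegrable _ _).continuousOn_mul h.continuousOn)] at key
  have e : ∀ k : ℝ → ℝ, (∀ x, x ∉ Ioo a b → k x = 0) → ∫ x, k x = ∫ x in a..b, k x := by
    intro k hk
    rw [intervalIntegral.integral_of_le hab, setIntegral_eq_integral_of_forall_compl_eq_zero]
    exact fun x hx => hk x fun h' => hx (Ioo_subset_Ioc_self h')
  rw [e _ fun x hx => by rw [hz' x hx, mul_zero], e _ fun x hx => by rw [hz x hx, mul_zero]]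
  linarith

lemma IsPrim.isWeakDeriv_one {f g : ℝ → ℝ} (h : IsPrim f g) : IsWeakDeriv 1 f g := by
  refine ⟨h.continuous.locallyIntegrable, h.locallyIntegrable, fun φ hφ hc => ?_⟩
  obtain ⟨R, hR⟩ := hc.isBounded.subset_ball 0
  have hR' : tsupport φ ⊆ Ioo (-|R|) |R| := fun x hx => by
    have := hR hx
    rw [Metric.mem_ball, Real.dist_eq, sub_zero] at this
    exact abs_lt.1 (this.trans_le (le_abs_self R))
  rw [iteratedDeriv_one, pow_one, neg_one_mul]
  exact (h _ _).integral_mul_deriv (by linarith [abs_nonneg R]) hφ hR'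

lemma IsWeakDeriv.succ {k : ℕ} {f g g' : ℝ → ℝ} (h : IsWeakDeriv k f g) (h' : IsPrim g g') :
    IsWeakDeriv (k + 1) f g' := by
  refine ⟨h.1, h'.locallyIntegrable, fun φ hφ hc => ?_⟩
  have h1 := h.2.2 (deriv φ) (by fun_prop) hc.deriv
  have h2 := h'.isWeakDeriv_one.2.2 φ hφ hc
  rw [iteratedDeriv_one] at h2
  rw [iteratedDeriv_succ', h1, h2, pow_one, pow_succ, mul_assoc]

/-! ### The du Bois-Reymond lemma -/

/-- A smooth function of integral zero supported in `(a, b)` is the derivative of a smooth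
function supported in `(a, b)`. -/
lemma exists_deriv_eq_of_integral_eq_zero {a b : ℝ} {η : ℝ → ℝ} (hη : ContDiff ℝ ∞ η)
    (hc : HasCompactSupport η) (hs : tsupport η ⊆ Ioo a b) (h0 : ∫ x, η x = 0) :
    ∃ φ : ℝ → ℝ, ContDiff ℝ ∞ φ ∧ HasCompactSupport φ ∧ tsupport φ ⊆ Ioo a b ∧ deriv φ = η := by
  rcases (tsupport η).eq_empty_or_nonempty with he | hne
  · refine ⟨0, contDiff_const, HasCompactSupport.zero, ?_, ?_⟩
    · rw [tsupport_eq_empty_iff.2 rfl]; exact empty_subset _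
    · rw [tsupport_eq_empty_iff.1 he]; ext x; simp
  obtain ⟨p, hp⟩ := hc.isCompact.exists_isLeast hne
  obtain ⟨q, hq⟩ := hc.isCompact.exists_isGreatest hne
  have hpq : p ≤ q := hp.2 hq.1
  have hz : ∀ x, x ∉ Icc p q → η x = 0 := fun x hx =>
    image_eq_zero_of_notMem_tsupport fun h => hx ⟨hp.2 h, hq.2 h⟩
  have hd : ∀ x, HasDerivAt (fun x => ∫ y in p..x, η y) (η x) x := fun x =>
    (hη.continuous.integral_hasStrictDerivAt p x).hasDerivAt
  have hde : deriv (fun x => ∫ y in p..x, η y) = η := funext fun x => (hd x).deriv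
  have hsub : Function.support (fun x => ∫ y in p..x, η y) ⊆ Icc p q := by
    intro x hx
    by_contra hxn
    refine hx ?_
    simp only
    rcases lt_or_ge x p with h | h
    · refine intervalIntegral.integral_zero_ae ?_
      filter_upwards [show ∀ᵐ y : ℝ, y ≠ p by simp [ae_iff]] with y hy hyx
      rw [uIoc_of_ge h.le] at hyx
      exact hz y fun h' => hy (le_antisymm hyx.2 h'.1)
    · have hqx : q < x := by
        by_contra hq'
        exact hxn ⟨h, not_lt.1 hq'⟩
      rw [← h0, intervalIntegral.integral_of_le h, ← integral_Icc_eq_integral_Ioc]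
      refine setIntegral_eq_integral_of_forall_compl_eq_zero fun y hy => hz y fun h' => hy ?_
      exact ⟨h'.1, h'.2.trans hqx.le⟩
  have hts : tsupport (fun x => ∫ y in p..x, η y) ⊆ Icc p q := closure_minimal hsub isClosed_Icc
  refine ⟨fun x => ∫ y in p..x, η y, ?_, ?_, ?_, hde⟩
  · refine contDiff_infty_iff_deriv.2 ⟨fun x => (hd x).differentiableAt, ?_⟩
    rw [hde]; exact hη
  · exact isCompact_Icc.of_isClosed_subset isClosed_closure hts
  · exact hts.trans fun x hx => ⟨(hs hp.1).1.trans_le hx.1, hx.2.trans_lt (hs hq.1).2⟩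

/-- A function on `(a, b)` whose weak derivative is integrable agrees almost everywhere with a
primitive of it. -/
lemma ae_eq_const_add_integral {a b c : ℝ} {f g : ℝ → ℝ} (hc : c ∈ Ioo a b)
    (hf : IntegrableOn f (Ioo a b)) (hg : IntegrableOn g (Ioo a b))
    (h : ∀ φ : ℝ → ℝ, ContDiff ℝ ∞ φ → HasCompactSupport φ → tsupport φ ⊆ Ioo a b →
      ∫ x, f x * deriv φ x = -∫ x, g x * φ x) :
    ∃ C : ℝ, ∀ᵐ x, x ∈ Ioo a b → f x = C + ∫ y in c..x, g y := by
  have hab : a < b := hc.1.trans hc.2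
  have hgi : IntervalIntegrable g volume a b :=
    (intervalIntegrable_iff_integrableOn_Ioo_of_le hab.le).2 hg
  set G : ℝ → ℝ := fun x => ∫ y in c..x, g y with hG
  have hsub : ∀ {x y}, x ∈ Icc a b → y ∈ Icc a b → IntervalIntegrable g volume x y := by
    intro x y hx hy
    refine hgi.mono_set ?_
    rw [uIcc_of_le hab.le]
    exact OrdConnected.uIcc_subset ordConnected_Icc hx hy
  have hcI := Ioo_subset_Icc_self hc
  have hGp : IsPrimOn a b G g := by
    refine ⟨hgi, fun x hx => ?_⟩
    rw [uIcc_of_le hab.le] at hx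
    rw [hG, intervalIntegral.integral_interval_sub_left (hsub hcI hx)
      (hsub hcI (left_mem_Icc.2 hab.le))]
  have hGi : IntegrableOn G (Ioo a b) := by
    have := hGp.continuousOn
    rw [uIcc_of_le hab.le] at this
    exact (this.integrableOn_Icc).mono_set Ioo_subset_Icc_self
  have hH : IntegrableOn (fun x => f x - G x) (Ioo a b) := hf.sub hGi
  -- products with functions supported in `(a, b)` are integrable on the line
  have hint : ∀ {k ψ : ℝ → ℝ}, IntegrableOn k (Ioo a b) → Continuous ψ → HasCompactSupport ψ →
      tsupport ψ ⊆ Ioo a b → Integrable (fun x => k x * ψ x) := by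
    intro k ψ hk hψ hcs hs
    have h1 : IntegrableOn (fun x => k x * ψ x) (Ioo a b) := by
      obtain ⟨M, hM⟩ := hψ.bounded_above_of_compact_support hcs
      exact hk.mul_bdd hψ.aestronglyMeasurable (Eventually.of_forall hM)
    refine (integrableOn_iff_integrable_of_support_subset fun x hx => ?_).1 h1
    by_contra hxn
    refine hx ?_
    simp only
    rw [image_eq_zero_of_notMem_tsupport fun h' => hxn (hs h'), mul_zero]
  have hHφ : ∀ φ : ℝ → ℝ, ContDiff ℝ ∞ φ → HasCompactSupport φ → tsupport φ ⊆ Ioo a b →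
      ∫ x, (f x - G x) * deriv φ x = 0 := by
    intro φ hφ hcs hs
    have hd : Continuous (deriv φ) := hφ.continuous_deriv (by norm_num)
    have hs' := (tsupport_deriv_subset (𝕜 := ℝ) (f := φ)).trans hs
    simp_rw [sub_mul]
    rw [integral_sub (hint hf hd hcs.deriv hs') (hint hGi hd hcs.deriv hs'), h φ hφ hcs hs,
      hGp.integral_mul_deriv hab.le hφ hs, sub_self]
  obtain ⟨r, hr, hrs⟩ := Metric.isOpen_iff.1 (isOpen_Ioo (a := a) (b := b)) c hc
  -- subtracting a multiple of the bump `B` leaves integral zero, hence a derivative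
  let B : ContDiffBump c := ⟨r / 4, r / 2, by linarith, by linarith⟩
  have hBc : HasCompactSupport (B.normed volume) := B.hasCompactSupport_normed
  have hBd : ContDiff ℝ ∞ (B.normed volume) := B.contDiff_normed
  have hBs : tsupport (B.normed volume) ⊆ Ioo a b := by
    rw [B.tsupport_normed_eq]
    exact (Metric.closedBall_subset_ball (by change r / 2 < r; linarith)).trans hrs
  refine ⟨∫ x, (f x - G x) * B.normed volume x, ?_⟩
  set C := ∫ x, (f x - G x) * B.normed volume x with hC
  have key : ∀ᵐ x, x ∈ Ioo a b → (f x - G x) - C = 0 := by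
    refine isOpen_Ioo.ae_eq_zero_of_integral_contDiff_smul_eq_zero
      (f := fun x => (f x - G x) - C) ?_ ?_
    · exact (hH.sub (integrableOn_const (by simp))).locallyIntegrableOn
    · intro ψ hψ hcs hs
      have hηs : tsupport (fun x => ψ x - (∫ y, ψ y) * B.normed volume x) ⊆ Ioo a b := by
        refine (tsupport_sub _ _).trans (union_subset hs ?_)
        exact (tsupport_mul_subset_right).trans hBs
      have hηc : HasCompactSupport (fun x => ψ x - (∫ y, ψ y) * B.normed volume x) :=
        hcs.sub hBc.mul_left
      have hψi : Integrable ψ := hψ.continuous.integrable_of_hasCompactSupport hcs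
      obtain ⟨φ, h1, h2, h3, h4⟩ := exists_deriv_eq_of_integral_eq_zero
        (η := fun x => ψ x - (∫ y, ψ y) * B.normed volume x)
        (hψ.sub (contDiff_const.mul hBd)) hηc hηs (by
          rw [integral_sub hψi (B.integrable_normed.const_mul _), integral_const_mul,
            B.integral_normed, mul_one, sub_self])
      have h5 := hHφ φ h1 h2 h3
      rw [h4] at h5
      have h6 : ∫ x, ((f x - G x) * ψ x - (∫ y, ψ y) * ((f x - G x) * B.normed volume x)) = 0 := by
        rw [← h5]; congr 1; ext x; ring
      rw [integral_sub (hint hH hψ.continuous hcs hs)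
        ((hint hH hBd.continuous hBc hBs).const_mul _), integral_const_mul] at h6
      have h7 : ∫ x, ψ x • (f x - G x - C) = ∫ x, ((f x - G x) * ψ x - C * ψ x) := by
        congr 1; ext x; simp only [smul_eq_mul]; ring
      rw [h7, integral_sub (hint hH hψ.continuous hcs hs) (hψi.const_mul _), integral_const_mul]
      linarith
  filter_upwards [key] with x hx hxm
  linarith [hx hxm]

/-- A locally integrable function on the line with a weak derivative has a locally absolutely
continuous representative. -/
lemma IsWeakDeriv.exists_isPrim {f g : ℝ → ℝ} (h : IsWeakDeriv 1 f g) :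
    ∃ f' : ℝ → ℝ, f =ᵐ[volume] f' ∧ IsPrim f' g := by
  have hloc : ∀ {k : ℝ → ℝ}, LocallyIntegrable k volume → ∀ a b : ℝ, IntegrableOn k (Ioo a b) :=
    fun hk a b => (hk.integrableOn_isCompact (isCompact_Icc (a := a) (b := b))).mono_set
      Ioo_subset_Icc_self
  have h1 : ∀ n : ℕ, ∃ C : ℝ, ∀ᵐ x, x ∈ Ioo (-(n + 1 : ℝ)) (n + 1) → f x = C + ∫ y in 0..x, g y :=
    fun n => ae_eq_const_add_integral (by constructor <;> linarith [n.cast_nonneg (α := ℝ)])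
      (hloc h.1 _ _) (hloc h.2.1 _ _) fun φ hφ hc _ => by
        have := h.2.2 φ hφ hc
        rwa [iteratedDeriv_one, pow_one, neg_one_mul] at this
  choose C hC using h1
  have hCe : ∀ n, C n = C 0 := by
    intro n
    have h2 : ∀ᵐ x : ℝ, x ∈ Ioo (-1 : ℝ) 1 → C n = C 0 := by
      filter_upwards [hC n, hC 0] with x hx hx0 hxm
      have hn := n.cast_nonneg (α := ℝ)
      have e1 := hx ⟨by linarith [hxm.1], by linarith [hxm.2]⟩
      have e2 := hx0 ⟨by simpa using hxm.1, by simpa using hxm.2⟩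
      linarith
    by_contra hne
    have h3 : ∀ᵐ x : ℝ, x ∉ Ioo (-1 : ℝ) 1 := h2.mono fun x hx hxm => hne (hx hxm)
    have h4 : volume (Ioo (-1 : ℝ) 1) = 0 := measure_eq_zero_iff_ae_notMem.2 h3
    rw [Real.volume_Ioo] at h4
    norm_num at h4
  have hi : ∀ a b, IntervalIntegrable g volume a b := fun a b =>
    (h.2.1.integrableOn_isCompact isCompact_uIcc).intervalIntegrable
  refine ⟨fun x => C 0 + ∫ y in 0..x, g y, ?_, fun a b => ⟨hi a b, fun x _ => ?_⟩⟩
  · filter_upwards [ae_all_iff.2 hC] with x hx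
    obtain ⟨n, hn⟩ := exists_nat_gt |x|
    have := hx n ⟨by linarith [neg_abs_le x], by linarith [le_abs_self x]⟩
    rw [this, hCe n]
  · rw [← intervalIntegral.integral_interval_sub_left (hi 0 x) (hi 0 a)]
    ring

/-! ### Real Fourier coefficients on the period cell -/

/-- The cosine coefficient `∫₀¹ f(h) cos(2πnh) dh`. It is the real part of the complex Fourier
coefficient, so Parseval's identity holds without weights when `n` runs over all of `ℤ`. -/
noncomputable def cosCoeff (n : ℤ) (f : ℝ → ℝ) : ℝ :=
  ∫ h in (0 : ℝ)..1, f h * Real.cos (2 * Real.pi * n * h)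

/-- The sine coefficient `∫₀¹ f(h) sin(2πnh) dh`, up to sign the imaginary part of the complex
Fourier coefficient. -/
noncomputable def sinCoeff (n : ℤ) (f : ℝ → ℝ) : ℝ :=
  ∫ h in (0 : ℝ)..1, f h * Real.sin (2 * Real.pi * n * h)

lemma cell_eq_restrict_Ioc : cell = volume.restrict (Ioc (0 : ℝ) 1) :=
  Measure.restrict_congr_set Ioc_ae_eq_Icc.symm

lemma integral_cell (f : ℝ → ℝ) : ∫ h, f h ∂cell = ∫ h in (0 : ℝ)..1, f h := by
  rw [cell_eq_restrict_Ioc, intervalIntegral.integral_of_le zero_le_one]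

lemma intervalIntegrable_iff_integrable_cell {f : ℝ → ℝ} :
    IntervalIntegrable f volume 0 1 ↔ Integrable f cell := by
  rw [cell_eq_restrict_Ioc, intervalIntegrable_iff_integrableOn_Ioc_of_le zero_le_one,
    IntegrableOn]

instance : IsProbabilityMeasure cell := ⟨by simp [cell]⟩

lemma memLp_cell_intervalIntegrable {f : ℝ → ℝ} (hf : MemLp f 2 cell) :
    IntervalIntegrable f volume 0 1 :=
  intervalIntegrable_iff_integrable_cell.2 (hf.integrable (by norm_num))

lemma intervalIntegral_congr_cell {f g : ℝ → ℝ} (h : f =ᵐ[cell] g) :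
    ∫ x in (0 : ℝ)..1, f x = ∫ x in (0 : ℝ)..1, g x := by
  rw [← integral_cell, ← integral_cell]
  exact integral_congr_ae h

lemma cosCoeff_congr {n : ℤ} {f g : ℝ → ℝ} (h : f =ᵐ[cell] g) : cosCoeff n f = cosCoeff n g :=
  intervalIntegral_congr_cell (h.mono fun x hx => by simp only [hx])

lemma sinCoeff_congr {n : ℤ} {f g : ℝ → ℝ} (h : f =ᵐ[cell] g) : sinCoeff n f = sinCoeff n g :=
  intervalIntegral_congr_cell (h.mono fun x hx => by simp only [hx])

lemma continuous_cos_mode (n : ℤ) : Continuous fun h : ℝ => Real.cos (2 * Real.pi * n * h) := by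
  fun_prop

lemma continuous_sin_mode (n : ℤ) : Continuous fun h : ℝ => Real.sin (2 * Real.pi * n * h) := by
  fun_prop

lemma cosCoeff_add {n : ℤ} {f g : ℝ → ℝ} (hf : IntervalIntegrable f volume 0 1)
    (hg : IntervalIntegrable g volume 0 1) :
    cosCoeff n (fun x => f x + g x) = cosCoeff n f + cosCoeff n g := by
  simp only [cosCoeff, add_mul]
  exact intervalIntegral.integral_add (hf.mul_continuousOn (continuous_cos_mode n).continuousOn)
    (hg.mul_continuousOn (continuous_cos_mode n).continuousOn)

lemma sinCoeff_add {n : ℤ} {f g : ℝ → ℝ} (hf : IntervalIntegrable f volume 0 1)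
    (hg : IntervalIntegrable g volume 0 1) :
    sinCoeff n (fun x => f x + g x) = sinCoeff n f + sinCoeff n g := by
  simp only [sinCoeff, add_mul]
  exact intervalIntegral.integral_add (hf.mul_continuousOn (continuous_sin_mode n).continuousOn)
    (hg.mul_continuousOn (continuous_sin_mode n).continuousOn)

lemma cosCoeff_sub {n : ℤ} {f g : ℝ → ℝ} (hf : IntervalIntegrable f volume 0 1)
    (hg : IntervalIntegrable g volume 0 1) :
    cosCoeff n (fun x => f x - g x) = cosCoeff n f - cosCoeff n g := by
  simp only [cosCoeff, sub_mul]
  exact intervalIntegral.integral_sub (hf.mul_continuousOn (continuous_cos_mode n).continuousOn)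
    (hg.mul_continuousOn (continuous_cos_mode n).continuousOn)

lemma sinCoeff_sub {n : ℤ} {f g : ℝ → ℝ} (hf : IntervalIntegrable f volume 0 1)
    (hg : IntervalIntegrable g volume 0 1) :
    sinCoeff n (fun x => f x - g x) = sinCoeff n f - sinCoeff n g := by
  simp only [sinCoeff, sub_mul]
  exact intervalIntegral.integral_sub (hf.mul_continuousOn (continuous_sin_mode n).continuousOn)
    (hg.mul_continuousOn (continuous_sin_mode n).continuousOn)

lemma norm_sq_fourierCoeffOn {f : ℝ → ℝ} (hf : IntervalIntegrable f volume 0 1) (n : ℤ) :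
    ‖fourierCoeffOn (zero_lt_one' ℝ) (fun x => (f x : ℂ)) n‖ ^ 2 =
      cosCoeff n f ^ 2 + sinCoeff n f ^ 2 := by
  have hof : ∀ {k : ℝ → ℝ}, IntervalIntegrable k volume 0 1 →
      IntervalIntegrable (fun x => (k x : ℂ)) volume 0 1 := fun hk => ⟨hk.1.ofReal, hk.2.ofReal⟩
  have h1 : fourierCoeffOn (zero_lt_one' ℝ) (fun x => (f x : ℂ)) n =
      (cosCoeff n f : ℂ) - sinCoeff n f * Complex.I := by
    rw [fourierCoeffOn_eq_integral, cosCoeff, sinCoeff, ← intervalIntegral.integral_ofReal,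
      ← intervalIntegral.integral_ofReal, ← intervalIntegral.integral_mul_const,
      ← intervalIntegral.integral_sub]
    · rw [sub_zero, div_one, one_smul]
      refine intervalIntegral.integral_congr fun x _ => ?_
      rw [fourier_coe_apply]
      have : (2 * Real.pi * Complex.I * ((-n : ℤ) : ℂ) * (x : ℂ) / ((1 : ℝ) - (0 : ℝ) : ℝ) : ℂ)
          = ((-(2 * Real.pi * n * x) : ℝ) : ℂ) * Complex.I := by
        push_cast; ring
      rw [sub_zero] at this
      rw [this, Complex.exp_mul_I, ← Complex.ofReal_cos, ← Complex.ofReal_sin, Real.cos_neg,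
        Real.sin_neg, smul_eq_mul]
      push_cast
      ring
    · exact hof (hf.mul_continuousOn (continuous_cos_mode n).continuousOn)
    · exact (hof (hf.mul_continuousOn (continuous_sin_mode n).continuousOn)).mul_const _
  rw [h1, Complex.sq_norm, Complex.normSq_apply]
  simp
  ring

lemma hasSum_sq_coeff {f : ℝ → ℝ} (hf : MemLp f 2 cell) :
    HasSum (fun n : ℤ => cosCoeff n f ^ 2 + sinCoeff n f ^ 2) (∫ h in (0 : ℝ)..1, f h ^ 2) := by
  have h1 : MemLp (fun x => (f x : ℂ)) 2 (volume.restrict (Ioc (0 : ℝ) 1)) := by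
    rw [← cell_eq_restrict_Ioc]; exact hf.ofReal
  have h2 := hasSum_sq_fourierCoeffOn (zero_lt_one' ℝ) h1
  simpa [norm_sq_fourierCoeffOn (memLp_cell_intervalIntegrable hf)] using h2

/-- Parseval's identity for two real square integrable functions, by polarization. -/
lemma hasSum_mul_coeff {f g : ℝ → ℝ} (hf : MemLp f 2 cell) (hg : MemLp g 2 cell) :
    HasSum (fun n : ℤ => cosCoeff n f * cosCoeff n g + sinCoeff n f * sinCoeff n g)
      (∫ h in (0 : ℝ)..1, f h * g h) := by
  have hfi := memLp_cell_intervalIntegrable hf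
  have hgi := memLp_cell_intervalIntegrable hg
  have h1 := hasSum_sq_coeff (hf.add hg)
  have h2 := hasSum_sq_coeff (hf.sub hg)
  have h3 := (h1.sub h2).mul_left (1 / 4 : ℝ)
  have e1 := fun n : ℤ => cosCoeff_add (n := n) hfi hgi
  have e2 := fun n : ℤ => cosCoeff_sub (n := n) hfi hgi
  have e3 := fun n : ℤ => sinCoeff_add (n := n) hfi hgi
  have e4 := fun n : ℤ => sinCoeff_sub (n := n) hfi hgi
  have e5 : (fun n : ℤ => cosCoeff n f * cosCoeff n g + sinCoeff n f * sinCoeff n g) = fun n =>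
      1 / 4 * (cosCoeff n (f + g) ^ 2 + sinCoeff n (f + g) ^ 2 -
        (cosCoeff n (f - g) ^ 2 + sinCoeff n (f - g) ^ 2)) := by
    funext n
    change _ = 1 / 4 * ((cosCoeff n (fun x => f x + g x)) ^ 2 + sinCoeff n (fun x => f x + g x) ^ 2
      - (cosCoeff n (fun x => f x - g x) ^ 2 + sinCoeff n (fun x => f x - g x) ^ 2))
    rw [e1, e2, e3, e4]
    ring
  rw [← intervalIntegral.integral_sub
      (intervalIntegrable_iff_integrable_cell.2 (hf.add hg).integrable_sq)
      (intervalIntegrable_iff_integrable_cell.2 (hf.sub hg).integrable_sq),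
      ← intervalIntegral.integral_const_mul, ← e5] at h3
  have e6 : ∫ h in (0 : ℝ)..1, f h * g h =
      ∫ h in (0 : ℝ)..1, 1 / 4 * ((f + g) h ^ 2 - (f - g) h ^ 2) := by
    congr 1
    funext x
    simp only [Pi.add_apply, Pi.sub_apply]
    ring
  rw [e6]
  exact h3

/-- Integration by parts over a period; the boundary terms cancel by periodicity. -/
lemma IsPrim.integral_mul_eq_neg {f g e e' : ℝ → ℝ} (h : IsPrim f g) (he : IsPrim e e')
    (he' : Continuous e') (hf : f 1 = f 0) (he1 : e 1 = e 0) :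
    ∫ x in (0 : ℝ)..1, g x * e x = -∫ x in (0 : ℝ)..1, f x * e' x := by
  have h1 := (h.mul he).integral_eq 0 1
  rw [intervalIntegral.integral_add ((h 0 1).1.mul_continuousOn he.continuous.continuousOn)
    ((Continuous.fun_mul h.continuous he').intervalIntegrable _ _), hf, he1, sub_self] at h1
  linarith

lemma IsPrim.cosCoeff_deriv {f g : ℝ → ℝ} (h : IsPrim f g) (hf : Function.Periodic f 1) (n : ℤ) :
    cosCoeff n g = 2 * Real.pi * n * sinCoeff n f := by
  have hc : IsPrim (fun x : ℝ => Real.cos (2 * Real.pi * n * x))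
      (fun x => -(2 * Real.pi * n) * Real.sin (2 * Real.pi * n * x)) := by
    refine IsPrim.of_hasDerivAt (fun x => ?_) (by fun_prop)
    have := ((hasDerivAt_id' x).const_mul (2 * Real.pi * n)).cos
    convert this using 1
    ring
  have h3 : Real.cos (2 * Real.pi * n * 1) = Real.cos (2 * Real.pi * n * 0) := by
    rw [mul_one, mul_zero, Real.cos_zero, mul_comm]
    exact Real.cos_int_mul_two_pi n
  rw [cosCoeff, h.integral_mul_eq_neg hc (by fun_prop) (by simpa using hf 0) h3, sinCoeff,
    ← intervalIntegral.integral_const_mul, ← intervalIntegral.integral_neg]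
  congr 1; ext x; ring

lemma IsPrim.sinCoeff_deriv {f g : ℝ → ℝ} (h : IsPrim f g) (hf : Function.Periodic f 1) (n : ℤ) :
    sinCoeff n g = -(2 * Real.pi * n * cosCoeff n f) := by
  have hc : IsPrim (fun x : ℝ => Real.sin (2 * Real.pi * n * x))
      (fun x => (2 * Real.pi * n) * Real.cos (2 * Real.pi * n * x)) := by
    refine IsPrim.of_hasDerivAt (fun x => ?_) (by fun_prop)
    have := ((hasDerivAt_id' x).const_mul (2 * Real.pi * n)).sin
    convert this using 1
    ring
  have h3 : Real.sin (2 * Real.pi * n * 1) = Real.sin (2 * Real.pi * n * 0) := by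
    rw [mul_one, mul_zero, Real.sin_zero, mul_comm, ← sub_zero ((n : ℝ) * _)]
    simpa using Real.sin_int_mul_two_pi_sub 0 n
  rw [sinCoeff, h.integral_mul_eq_neg hc (by fun_prop) (by simpa using hf 0) h3, cosCoeff,
    ← intervalIntegral.integral_const_mul]
  congr 2; ext x; ring

/-! ### Profiles in periodic Sobolev spaces -/

/-- The functions `f, f', …, f^{(k-1)}` are locally absolutely continuous, so that `f^{(k)}` exists
as a locally integrable function; for `k = 0`, `f` itself is locally integrable. This is the class
`W^{k,1}_loc`, with `f` its continuous representative when `k ≥ 1`. -/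
def PrimChain : ℕ → (ℝ → ℝ) → Prop
  | 0, f => LocallyIntegrable f volume
  | k + 1, f => ∃ g, IsPrim f g ∧ PrimChain k g

lemma PrimChain.pred {k : ℕ} {f : ℝ → ℝ} (h : PrimChain (k + 1) f) : PrimChain k f := by
  induction k generalizing f with
  | zero => obtain ⟨g, hg, _⟩ := h; exact hg.continuous.locallyIntegrable
  | succ k ih => obtain ⟨g, hg, hk⟩ := h; exact ⟨g, hg, ih hk⟩

lemma PrimChain.add {k : ℕ} {f g : ℝ → ℝ} (hf : PrimChain k f) (hg : PrimChain k g) :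
    PrimChain k (fun x => f x + g x) := by
  induction k generalizing f g with
  | zero => exact LocallyIntegrable.add hf hg
  | succ k ih =>
    obtain ⟨f', hf', hfk⟩ := hf
    obtain ⟨g', hg', hgk⟩ := hg
    exact ⟨_, hf'.add hg', ih hfk hgk⟩

lemma PrimChain.mul {k : ℕ} {f g : ℝ → ℝ} (hf : PrimChain (k + 1) f) (hg : PrimChain (k + 1) g) :
    PrimChain (k + 1) (fun x => f x * g x) := by
  induction k generalizing f g with
  | zero =>
    obtain ⟨f', hf', -⟩ := hf
    obtain ⟨g', hg', -⟩ := hg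
    exact ⟨_, hf'.mul hg', (hf'.mul hg').locallyIntegrable⟩
  | succ k ih =>
    have hf1 := hf.pred
    have hg1 := hg.pred
    obtain ⟨f', hf', hfk⟩ := hf
    obtain ⟨g', hg', hgk⟩ := hg
    exact ⟨_, hf'.mul hg', (ih hfk hg1).add (ih hf1 hgk)⟩

/-- A chain of weak derivatives of order one has a representative built from iterated primitives;
the top derivative is left unchanged and the lower ones are adjusted on null sets. -/
lemma exists_primChain {k : ℕ} {g : ℕ → ℝ → ℝ} (hloc : LocallyIntegrable (g 0) volume)
    (h : ∀ j < k, IsWeakDeriv 1 (g j) (g (j + 1))) :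
    ∃ f, g 0 =ᵐ[volume] f ∧ PrimChain k f := by
  induction k generalizing g with
  | zero => exact ⟨g 0, EventuallyEq.rfl, hloc⟩
  | succ k ih =>
    have h0 := h 0 k.succ_pos
    obtain ⟨f₁, hf₁, hc⟩ := ih (g := fun j => g (j + 1)) h0.2.1 fun j hj =>
      h (j + 1) (Nat.succ_lt_succ hj)
    obtain ⟨f, hf, hp⟩ := h0.exists_isPrim
    exact ⟨f, hf, f₁, fun a b => (hp a b).congr_right hf₁, hc⟩

lemma isWeakDeriv_zero {f : ℝ → ℝ} (hf : LocallyIntegrable f volume) : IsWeakDeriv 0 f f :=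
  ⟨hf, hf, fun φ _ _ => by simp⟩

lemma MemHper.primChain {k : ℕ} {f : ℝ → ℝ} (h : MemHper (k + 1) f) (hf : Continuous f) :
    PrimChain (k + 1) f := by
  choose! g hg _ using h.2
  have h0 : g 0 =ᵐ[volume] f :=
    (hg 0 (Nat.zero_le _)).ae_eq (isWeakDeriv_zero hf.locallyIntegrable)
  obtain ⟨f', hf', hc⟩ := exists_primChain (k := k + 1) (g := g) (hg 0 (Nat.zero_le _)).2.1
    fun j hj => (hg j hj.le).step (hg (j + 1) hj)
  have hcont : Continuous f' := by
    obtain ⟨_, hp, -⟩ := hc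
    exact hp.continuous
  have : f = f' := MeasureTheory.Measure.eq_of_ae_eq (h0.symm.trans hf') hf hcont
  rwa [this]

lemma MemHper.periodic {k : ℕ} {f : ℝ → ℝ} (h : MemHper k f) (hf : Continuous f) :
    Function.Periodic f 1 := by
  have : (fun x => f (x + 1)) = f :=
    MeasureTheory.Measure.eq_of_ae_eq (μ := volume) h.1 (by fun_prop) hf
  exact fun x => congrFun this x

/-! ### Energy, slope and lower bounds of a profile -/

lemma IsPrim.comp {f g φ φ' : ℝ → ℝ} (h : IsPrim f g) (hφ : ∀ y, HasDerivAt φ (φ' y) y)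
    (hφ' : Continuous φ') : IsPrim (fun x => φ (f x)) (fun x => φ' (f x) * g x) := by
  intro a b
  obtain ⟨M, hM⟩ := isCompact_uIcc.exists_bound_of_continuousOn (h a b).continuousOn
  exact (h a b).comp (c := -M) (d := M) (fun y _ => hφ y) hφ'.continuousOn
    fun x hx => abs_le.1 (hM x hx)

lemma memLp_cell_continuous_mul {f g : ℝ → ℝ} (hf : Continuous f) (hg : MemLp g 2 cell) :
    MemLp (fun x => f x * g x) 2 cell := by
  obtain ⟨M, hM⟩ := (isCompact_Icc (a := (0 : ℝ)) (b := 1)).exists_bound_of_continuousOn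
    hf.continuousOn
  refine hg.of_le_mul (c := M) (hf.aestronglyMeasurable.mul hg.1) ?_
  filter_upwards [ae_restrict_mem measurableSet_Icc] with x hx
  rw [norm_mul]
  exact mul_le_mul_of_nonneg_right (hM x hx) (norm_nonneg _)

lemma memLp_cell_of_continuous {f : ℝ → ℝ} (hf : Continuous f) : MemLp f 2 cell := by
  simpa using memLp_cell_continuous_mul hf (memLp_const (1 : ℝ))

lemma hasDerivAt_cubic (y : ℝ) : HasDerivAt (fun y : ℝ => y ^ 3 + y) (3 * y ^ 2 + 1) y :=
  ((hasDerivAt_pow 3 y).add (hasDerivAt_id' y)).congr_deriv (by norm_num)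

/-- For an `H²` profile `f`, both `f` and `f³ + f` are continuously differentiable, the second
derivative of `f³ + f` is square integrable, and the energy is its squared `L²` norm. -/
lemma MemHper.exists_primitives {f : ℝ → ℝ} (h : MemHper 2 f) (hf : Continuous f) :
    ∃ f₁ v₂ : ℝ → ℝ, IsPrim f f₁ ∧ Continuous f₁ ∧
      IsPrim (fun x => f x ^ 3 + f x) (fun x => (3 * f x ^ 2 + 1) * f₁ x) ∧
      IsPrim (fun x => (3 * f x ^ 2 + 1) * f₁ x) v₂ ∧ MemLp v₂ 2 cell ∧
      energy f = ∫ x in (0 : ℝ)..1, v₂ x ^ 2 := by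
  obtain ⟨f₁, h1, f₂, h2, -⟩ := h.primChain hf
  have hf1 := h2.continuous
  obtain ⟨g, hg, hg2⟩ := h.2 2 le_rfl
  have hfg : f₂ =ᵐ[volume] g := (h1.isWeakDeriv_one.succ h2).ae_eq hg
  have hf2 : MemLp f₂ 2 cell := (memLp_congr_ae (ae_restrict_of_ae hfg)).2 hg2
  have hv1 : IsPrim (fun x => f x ^ 3 + f x) (fun x => (3 * f x ^ 2 + 1) * f₁ x) :=
    h1.comp hasDerivAt_cubic (by fun_prop)
  have hv2 := (h1.comp (φ := fun y => 3 * y ^ 2 + 1) (φ' := fun y => 6 * y) (fun y =>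
    (((hasDerivAt_pow 2 y).const_mul 3).add_const (1 : ℝ)).congr_deriv (by push_cast; ring)) (by fun_prop)).mul h2
  refine ⟨f₁, _, h1, hf1, hv1, hv2, ?_, ?_⟩
  · refine (memLp_cell_of_continuous ?_).add (memLp_cell_continuous_mul ?_ hf2) <;> fun_prop
  · have := ((hv1.isWeakDeriv_one).succ hv2).weakDeriv_ae_eq
    exact intervalIntegral.integral_congr_ae (this.mono fun x hx _ => by rw [hx])

lemma integral_abs_le_sqrt {g : ℝ → ℝ} (hg : MemLp g 2 cell) :
    ∫ x in (0 : ℝ)..1, |g x| ≤ √(∫ x in (0 : ℝ)..1, g x ^ 2) := by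
  have h1 := (memLp_cell_intervalIntegrable hg).abs
  have h2 := intervalIntegrable_iff_integrable_cell.2 hg.integrable_sq
  set c := ∫ x in (0 : ℝ)..1, |g x| with hc
  refine Real.le_sqrt_of_sq_le ?_
  have h3 : 0 ≤ ∫ x in (0 : ℝ)..1, (g x ^ 2 - 2 * c * |g x| + c ^ 2) :=
    intervalIntegral.integral_nonneg zero_le_one fun x _ => by
      rw [← sq_abs (g x)]
      nlinarith [sq_nonneg (|g x| - c)]
  rw [intervalIntegral.integral_add (h2.sub (h1.const_mul _)) (by simp),
    intervalIntegral.integral_sub h2 (h1.const_mul _), intervalIntegral.integral_const_mul,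
    ← hc, intervalIntegral.integral_const, smul_eq_mul] at h3
  linarith

lemma abs_intervalIntegral_le_cell {g : ℝ → ℝ} (hg : IntervalIntegrable g volume 0 1) {x y : ℝ}
    (hx : x ∈ Icc (0 : ℝ) 1) (hy : y ∈ Icc (0 : ℝ) 1) :
    |∫ z in x..y, g z| ≤ ∫ z in (0 : ℝ)..1, |g z| := by
  refine (intervalIntegral.norm_integral_le_integral_norm_uIoc (f := g)).trans ?_
  rw [intervalIntegral.integral_of_le zero_le_one]
  refine setIntegral_mono_set hg.abs.1 (Eventually.of_forall fun _ => abs_nonneg _) ?_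
  refine LE.le.eventuallyLE fun z hz => ?_
  exact ⟨(le_min hx.1 hy.1).trans_lt hz.1, hz.2.trans (max_le hx.2 hy.2)⟩

/-- The slope of a profile is controlled by its energy: the derivative of `f³ + f` vanishes
somewhere in the period, and `(f³ + f)' = (3f² + 1) f'` dominates `f'`. -/
lemma abs_deriv_le_sqrt_energy {f f₁ : ℝ → ℝ} (h : MemHper 2 f) (hf : Continuous f)
    (h1 : IsPrim f f₁) (hf1 : Continuous f₁) {x : ℝ} (hx : x ∈ Icc (0 : ℝ) 1) :
    |f₁ x| ≤ √(energy f) := by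
  obtain ⟨g, v₂, hg, hgc, hv, hv2, hL, hE⟩ := h.exists_primitives hf
  have hgf : g x = f₁ x := (hg.hasDerivAt hgc x).unique (h1.hasDerivAt hf1 x)
  have hp := h.periodic hf
  have hv1c := hv2.continuous
  obtain ⟨c, hc, hc0⟩ := exists_hasDerivAt_eq_zero (zero_lt_one' ℝ) hv.continuous.continuousOn
    (by have := hp 0; rw [zero_add] at this; simp only [this]) (fun y _ => hv.hasDerivAt hv1c y)
  have h2 := hv2.integral_eq c x
  simp only [hc0, sub_zero] at h2
  rw [hE, ← hgf]
  calc |g x| ≤ |(3 * f x ^ 2 + 1) * g x| := by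
        rw [abs_mul]
        refine le_mul_of_one_le_left (abs_nonneg _) ?_
        rw [abs_of_pos (by positivity)]
        linarith [sq_nonneg (f x)]
    _ ≤ ∫ z in (0 : ℝ)..1, |v₂ z| := by
        rw [← h2]
        exact abs_intervalIntegral_le_cell (memLp_cell_intervalIntegrable hL)
          (Ioo_subset_Icc_self hc) hx
    _ ≤ _ := integral_abs_le_sqrt hL

lemma abs_sub_le_sqrt_energy {f : ℝ → ℝ} (h : MemHper 2 f) (hf : Continuous f) {x y : ℝ}
    (hx : x ∈ Icc (0 : ℝ) 1) (hy : y ∈ Icc (0 : ℝ) 1) : |f x - f y| ≤ √(energy f) := by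
  obtain ⟨f₁, v₂, h1, hf1, -⟩ := h.exists_primitives hf
  rw [← h1.integral_eq y x]
  have h2 : ∀ z ∈ uIoc y x, ‖f₁ z‖ ≤ √(energy f) := fun z hz =>
    abs_deriv_le_sqrt_energy h hf h1 hf1
      ⟨(le_min hy.1 hx.1).trans hz.1.le, hz.2.trans (max_le hy.2 hx.2)⟩
  refine (intervalIntegral.norm_integral_le_of_norm_le_const h2).trans ?_
  refine mul_le_of_le_one_right (Real.sqrt_nonneg _) ?_
  rw [abs_le]
  constructor <;> linarith [hx.1, hx.2, hy.1, hy.2]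

lemma exists_eq_inv_integral {f : ℝ → ℝ} (hf : Continuous f) (hpos : ∀ x, 0 < f x) {L : ℝ}
    (hL : ∫ x in (0 : ℝ)..1, (f x)⁻¹ = L) : ∃ y ∈ Icc (0 : ℝ) 1, f y = 1 / L := by
  have hc : Continuous fun x => (f x)⁻¹ := hf.inv₀ fun x => (hpos x).ne'
  obtain ⟨y, hy, h⟩ := exists_eq_interval_average (zero_ne_one' ℝ) hc.continuousOn
  rw [interval_average_eq_div, hL, sub_zero, div_one] at h
  refine ⟨y, ?_, by rw [← h, one_div, inv_inv]⟩
  rw [uIoo_of_le zero_le_one] at hy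
  exact Ioo_subset_Icc_self hy

/-- A positive profile with `∫ 1/f = L` is bounded below in terms of `L` and its energy: the
variation of `log f` is at most `∫ |f'|/f ≤ √E · L`. -/
lemma lower_bound {f : ℝ → ℝ} (h : MemHper 2 f) (hf : Continuous f) (hpos : ∀ x, 0 < f x) {L : ℝ}
    (hL : ∫ x in (0 : ℝ)..1, (f x)⁻¹ = L) {x : ℝ} (hx : x ∈ Icc (0 : ℝ) 1) :
    1 / L * Real.exp (-(√(energy f) * L)) ≤ f x := by
  obtain ⟨f₁, v₂, h1, hf1, -⟩ := h.exists_primitives hf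
  obtain ⟨y, hy, hfy⟩ := exists_eq_inv_integral hf hpos hL
  have hc : Continuous fun x => (f x)⁻¹ := hf.inv₀ fun x => (hpos x).ne'
  have hc1 : Continuous fun x => f₁ x / f x := hf1.div hf fun x => (hpos x).ne'
  have h2 : ∫ z in x..y, f₁ z / f z = Real.log (f y) - Real.log (f x) :=
    intervalIntegral.integral_eq_sub_of_hasDerivAt
      (fun z _ => (h1.hasDerivAt hf1 z).log (hpos z).ne') (hc1.intervalIntegrable _ _)
  have h3 : |∫ z in x..y, f₁ z / f z| ≤ √(energy f) * L := by
    refine (abs_intervalIntegral_le_cell (hc1.intervalIntegrable _ _) hx hy).trans ?_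
    rw [← hL, ← intervalIntegral.integral_const_mul]
    refine intervalIntegral.integral_mono_on zero_le_one (hc1.abs.intervalIntegrable _ _)
      ((hc.const_mul _).intervalIntegrable _ _) fun z hz => ?_
    rw [abs_div, abs_of_pos (hpos z), div_eq_mul_inv]
    exact mul_le_mul_of_nonneg_right (abs_deriv_le_sqrt_energy h hf h1 hf1 hz)
      (inv_nonneg.2 (hpos z).le)
  rw [← hfy, ← Real.exp_log (hpos x), ← Real.exp_log (hpos y), ← Real.exp_add]
  refine Real.exp_le_exp.2 ?_
  rw [h2] at h3
  linarith [le_abs_self (Real.log (f y) - Real.log (f x))]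

/-- Parseval's identity for the energy, in terms of the Fourier coefficients of `f³ + f`. -/
lemma MemHper.hasSum_energy {f : ℝ → ℝ} (h : MemHper 2 f) (hf : Continuous f) :
    HasSum (fun n : ℤ => (2 * Real.pi * n) ^ 4 * (cosCoeff n (fun x => f x ^ 3 + f x) ^ 2 +
      sinCoeff n (fun x => f x ^ 3 + f x) ^ 2)) (energy f) := by
  obtain ⟨f₁, v₂, h1, hf1, hv, hv2, hL, hE⟩ := h.exists_primitives hf
  have hp := h.periodic hf
  have hp0 : Function.Periodic (fun x => f x ^ 3 + f x) 1 := fun x => by simp only [hp x]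
  have hp1 := hv.periodic hv2.continuous hp0
  rw [hE]
  convert hasSum_sq_coeff hL using 2 with n
  rw [hv2.cosCoeff_deriv hp1, hv2.sinCoeff_deriv hp1, hv.cosCoeff_deriv hp0, hv.sinCoeff_deriv hp0]
  ring

/-- For an `H⁴` profile the fourth weak derivative of `f³ + f` exists, and its Fourier
coefficients are those of `f³ + f` multiplied by `(2πn)⁴`. -/
lemma MemHper.coeff_weakDeriv_four {f : ℝ → ℝ} (h : MemHper 4 f) (hf : Continuous f) (n : ℤ) :
    cosCoeff n (weakDeriv 4 fun x => f x ^ 3 + f x) =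
        (2 * Real.pi * n) ^ 4 * cosCoeff n (fun x => f x ^ 3 + f x) ∧
      sinCoeff n (weakDeriv 4 fun x => f x ^ 3 + f x) =
        (2 * Real.pi * n) ^ 4 * sinCoeff n (fun x => f x ^ 3 + f x) := by
  have hc : PrimChain 4 f := h.primChain hf
  have hcv : PrimChain 4 (fun x => f x ^ 3 + f x) := by
    have := ((hc.mul hc).mul hc).add hc
    convert this using 2
    ring
  obtain ⟨v₁, h1, v₂, h2, v₃, h3, v₄, h4, -⟩ := hcv
  have hp := h.periodic hf
  have hp0 : Function.Periodic (fun x => f x ^ 3 + f x) 1 := fun x => by simp only [hp x]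
  have hp1 := h1.periodic h2.continuous hp0
  have hp2 := h2.periodic h3.continuous hp1
  have hp3 := h3.periodic h4.continuous hp2
  have hw := ae_restrict_of_ae (s := Icc (0 : ℝ) 1)
    (((h1.isWeakDeriv_one.succ h2).succ h3).succ h4).weakDeriv_ae_eq
  constructor
  · rw [cosCoeff_congr hw, h4.cosCoeff_deriv hp3, h3.sinCoeff_deriv hp2, h2.cosCoeff_deriv hp1,
      h1.sinCoeff_deriv hp0]
    ring
  · rw [sinCoeff_congr hw, h4.sinCoeff_deriv hp3, h3.cosCoeff_deriv hp2, h2.sinCoeff_deriv hp1,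
      h1.cosCoeff_deriv hp0]
    ring

/-! ### Evolution of the Fourier coefficients and of the energy -/

/-- Lebesgue measure on the space-time rectangle `[0,T] × [0,1]`. -/
noncomputable def rect (T : ℝ) : Measure (ℝ × ℝ) := (volume.restrict (Icc 0 T)).prod cell

instance (T : ℝ) : IsFiniteMeasure (rect T) := by
  unfold rect; infer_instance

lemma rect_eq (T : ℝ) : rect T = volume.restrict (Icc (0 : ℝ) T ×ˢ Icc (0 : ℝ) 1) := by
  rw [rect, cell, Measure.prod_restrict, Measure.volume_eq_prod]

lemma exists_bound_rect {f : ℝ × ℝ → ℝ} (hf : Continuous f) (T : ℝ) :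
    ∃ M, ∀ᵐ p ∂rect T, ‖f p‖ ≤ M := by
  obtain ⟨M, hM⟩ := (isCompact_Icc.prod isCompact_Icc :
    IsCompact (Icc (0 : ℝ) T ×ˢ Icc (0 : ℝ) 1)).exists_bound_of_continuousOn hf.continuousOn
  refine ⟨M, ?_⟩
  rw [rect_eq]
  filter_upwards [ae_restrict_mem (measurableSet_Icc.prod measurableSet_Icc)] with p hp
  exact hM p hp

lemma memLp_rect_continuous_mul {f g : ℝ × ℝ → ℝ} {T : ℝ} (hf : Continuous f)
    (hg : MemLp g 2 (rect T)) : MemLp (fun p => f p * g p) 2 (rect T) := by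
  obtain ⟨M, hM⟩ := exists_bound_rect hf T
  refine hg.of_le_mul (c := M) (hf.aestronglyMeasurable.mul hg.1) ?_
  filter_upwards [hM] with p hp
  rw [norm_mul]
  exact mul_le_mul_of_nonneg_right hp (norm_nonneg _)

lemma integrable_rect_mul_continuous {f g : ℝ × ℝ → ℝ} {T : ℝ} (hg : Integrable g (rect T))
    (hf : Continuous f) : Integrable (fun p => g p * f p) (rect T) := by
  obtain ⟨M, hM⟩ := exists_bound_rect hf T
  exact hg.mul_bdd hf.aestronglyMeasurable hM

lemma ae_memLp_slice {T : ℝ} {Z : ℝ → ℝ → ℝ} (hZ : MemLp (fun p : ℝ × ℝ => Z p.1 p.2) 2 (rect T)) :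
    ∀ᵐ t ∂volume.restrict (Icc 0 T), MemLp (Z t) 2 cell := by
  filter_upwards [hZ.integrable_sq.prod_right_ae, hZ.1.prodMk_left] with t h1 h2
  exact (memLp_two_iff_integrable_sq h2).2 h1

lemma intervalIntegrable_iff_restrict_Icc {T : ℝ} (hT : 0 ≤ T) {f : ℝ → ℝ} :
    IntervalIntegrable f volume 0 T ↔ Integrable f (volume.restrict (Icc 0 T)) :=
  intervalIntegrable_iff_integrableOn_Icc_of_le hT

/-- Differentiation under the integral over the period: if `t ↦ V t h` is absolutely continuous
with derivative `Z t h` for almost every `h`, so is every weighted average over the period. -/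
lemma isPrimOn_integral {T : ℝ} (hT : 0 ≤ T) {V Z : ℝ → ℝ → ℝ} {e : ℝ → ℝ}
    (hV : Continuous fun p : ℝ × ℝ => V p.1 p.2)
    (hZ : Integrable (fun p : ℝ × ℝ => Z p.1 p.2) (rect T)) (he : Continuous e)
    (h : ∀ᵐ y ∂cell, IsPrimOn 0 T (fun t => V t y) (fun t => Z t y)) :
    IsPrimOn 0 T (fun t => ∫ y in (0 : ℝ)..1, V t y * e y)
      (fun t => ∫ y in (0 : ℝ)..1, Z t y * e y) := by
  have hZe : Integrable (fun p : ℝ × ℝ => Z p.1 p.2 * e p.2) (rect T) :=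
    integrable_rect_mul_continuous hZ (f := fun p => e p.2) (by fun_prop)
  simp only [← integral_cell]
  refine ⟨?_, fun x hx => ?_⟩
  · rw [intervalIntegrable_iff_restrict_Icc hT]
    exact hZe.integral_prod_left
  rw [uIcc_of_le hT] at hx
  have hVi : ∀ t, Integrable (fun y => V t y * e y) cell := fun t =>
    (memLp_cell_of_continuous (f := fun y => V t y * e y) (by fun_prop)).integrable (by norm_num)
  have hsub : Integrable (fun p : ℝ × ℝ => Z p.1 p.2 * e p.2)
      ((volume.restrict (Ioc 0 x)).prod cell) := by
    refine hZe.mono_measure ?_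
    rw [rect]
    exact Measure.prod_mono (Measure.restrict_mono
      (Ioc_subset_Icc_self.trans (Icc_subset_Icc_right hx.2)) le_rfl) le_rfl
  rw [← integral_sub (hVi x) (hVi 0), intervalIntegral.integral_of_le hx.1,
    integral_integral_swap hsub]
  refine integral_congr_ae ?_
  filter_upwards [h] with y hy
  have h1 := hy.2 x (by rw [uIcc_of_le hT]; exact hx)
  rw [← intervalIntegral.integral_of_le hx.1, intervalIntegral.integral_mul_const, ← h1]
  ring

lemma IsPrimOn.finset_sum {ι : Type*} {a b : ℝ} (s : Finset ι) {f g : ι → ℝ → ℝ}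
    (h : ∀ i, IsPrimOn a b (f i) (g i)) :
    IsPrimOn a b (fun x => ∑ i ∈ s, f i x) (fun x => ∑ i ∈ s, g i x) := by
  classical
  induction s using Finset.induction_on with
  | empty => simp [IsPrimOn]
  | insert i s hi ih =>
    simp only [Finset.sum_insert hi]
    exact (h i).add ih

lemma abs_sum_mul_coeff_le {f g : ℝ → ℝ} (hf : MemLp f 2 cell) (hg : MemLp g 2 cell)
    (s : Finset ℤ) :
    |∑ n ∈ s, 2 * (cosCoeff n f * cosCoeff n g + sinCoeff n f * sinCoeff n g)| ≤
      (∫ y in (0 : ℝ)..1, f y ^ 2) + ∫ y in (0 : ℝ)..1, g y ^ 2 := by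
  have h1 := sum_le_hasSum s (fun n _ => by positivity) (hasSum_sq_coeff hf)
  have h2 := sum_le_hasSum s (fun n _ => by positivity) (hasSum_sq_coeff hg)
  refine (Finset.abs_sum_le_sum_abs _ _).trans ((Finset.sum_le_sum fun n _ => ?_).trans
    ((Finset.sum_add_distrib).le.trans (add_le_add h1 h2)))
  rw [abs_le]
  constructor <;> nlinarith [sq_nonneg (cosCoeff n f - cosCoeff n g),
    sq_nonneg (sinCoeff n f - sinCoeff n g), sq_nonneg (cosCoeff n f + cosCoeff n g),
    sq_nonneg (sinCoeff n f + sinCoeff n g)]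

/-- The energy identity `dE/dt = 2 ∫ Q Z`, for `E = ∑ₙ (2πn)⁴ |V̂ₙ|²`, `Z = V_t` and
`Q = V_hhhh`, all expressed through Fourier coefficients in `h`. It holds for each Fourier mode by
the product rule, and the sum over the modes is taken by dominated convergence in time. -/
lemma energy_identity {T : ℝ} (hT : 0 ≤ T) {V Z Q : ℝ → ℝ → ℝ} {E : ℝ → ℝ}
    (hV : Continuous fun p : ℝ × ℝ => V p.1 p.2)
    (hZ : MemLp (fun p : ℝ × ℝ => Z p.1 p.2) 2 (rect T))
    (hQ : MemLp (fun p : ℝ × ℝ => Q p.1 p.2) 2 (rect T))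
    (h : ∀ᵐ y ∂cell, IsPrimOn 0 T (fun t => V t y) (fun t => Z t y))
    (hE : ∀ t ∈ Icc 0 T, HasSum (fun n : ℤ => (2 * Real.pi * n) ^ 4 *
      (cosCoeff n (V t) ^ 2 + sinCoeff n (V t) ^ 2)) (E t))
    (hQV : ∀ᵐ t ∂volume.restrict (Icc 0 T), ∀ n : ℤ,
      cosCoeff n (Q t) = (2 * Real.pi * n) ^ 4 * cosCoeff n (V t) ∧
      sinCoeff n (Q t) = (2 * Real.pi * n) ^ 4 * sinCoeff n (V t)) :
    IsPrimOn 0 T E (fun t => 2 * ∫ y in (0 : ℝ)..1, Q t y * Z t y) := by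
  have hZi : Integrable (fun p : ℝ × ℝ => Z p.1 p.2) (rect T) := hZ.integrable (by norm_num)
  have hc : ∀ n : ℤ, IsPrimOn 0 T (fun t => cosCoeff n (V t)) (fun t => cosCoeff n (Z t)) :=
    fun n => isPrimOn_integral hT hV hZi (continuous_cos_mode n) h
  have hs : ∀ n : ℤ, IsPrimOn 0 T (fun t => sinCoeff n (V t)) (fun t => sinCoeff n (Z t)) :=
    fun n => isPrimOn_integral hT hV hZi (continuous_sin_mode n) h
  have hmode := fun n : ℤ => (((hc n).mul (hc n)).add ((hs n).mul (hs n))).const_mul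
    ((2 * Real.pi * n) ^ 4)
  have hfin := fun s : Finset ℤ => IsPrimOn.finset_sum s hmode
  -- the derivative of a partial sum, rewritten through the coefficients of `Q`
  have hderiv : ∀ s : Finset ℤ, ∀ᵐ t ∂volume.restrict (Icc 0 T),
      ∑ n ∈ s, (2 * Real.pi * n) ^ 4 *
        (cosCoeff n (Z t) * cosCoeff n (V t) + cosCoeff n (V t) * cosCoeff n (Z t) +
          (sinCoeff n (Z t) * sinCoeff n (V t) + sinCoeff n (V t) * sinCoeff n (Z t))) =
      ∑ n ∈ s, 2 * (cosCoeff n (Q t) * cosCoeff n (Z t) + sinCoeff n (Q t) * sinCoeff n (Z t)) := by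
    intro s
    filter_upwards [hQV] with t ht
    refine Finset.sum_congr rfl fun n _ => ?_
    rw [(ht n).1, (ht n).2]
    ring
  have hZs := ae_memLp_slice hZ
  have hQs := ae_memLp_slice hQ
  have hbi : Integrable (fun t => (∫ y in (0 : ℝ)..1, Q t y ^ 2) + ∫ y in (0 : ℝ)..1, Z t y ^ 2)
      (volume.restrict (Icc 0 T)) := by
    simp only [← integral_cell]
    exact hQ.integrable_sq.integral_prod_left.add hZ.integrable_sq.integral_prod_left
  refine ⟨?_, fun x hx => ?_⟩
  · rw [intervalIntegrable_iff_restrict_Icc hT]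
    simp only [← integral_cell]
    exact (hQ.integrable_mul hZ).integral_prod_left.const_mul 2
  have hx' := hx
  rw [uIcc_of_le hT] at hx
  have h0 : (0 : ℝ) ∈ Icc 0 T := ⟨le_rfl, hT⟩
  have hsubset : uIoc 0 x ⊆ Icc 0 T := by
    rw [uIoc_of_le hx.1]
    exact fun t ht => ⟨ht.1.le, ht.2.trans hx.2⟩
  have hres : ∀ {p : ℝ → Prop}, (∀ᵐ t ∂volume.restrict (Icc 0 T), p t) →
      ∀ᵐ t, t ∈ uIoc 0 x → p t := fun hp =>
    ((ae_restrict_iff' measurableSet_Icc).1 hp).mono fun t ht htx => ht (hsubset htx)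
  have hlhs : Tendsto (fun s : Finset ℤ =>
      (∑ n ∈ s, (2 * Real.pi * n) ^ 4 * (cosCoeff n (V x) * cosCoeff n (V x) +
        sinCoeff n (V x) * sinCoeff n (V x))) -
      ∑ n ∈ s, (2 * Real.pi * n) ^ 4 * (cosCoeff n (V 0) * cosCoeff n (V 0) +
        sinCoeff n (V 0) * sinCoeff n (V 0))) atTop (𝓝 (E x - E 0)) := by
    have := (hE x hx).sub (hE 0 h0)
    simp only [pow_two (cosCoeff _ _), pow_two (sinCoeff _ _)] at this
    simpa only [HasSum, SummationFilter.unconditional_filter, Finset.sum_sub_distrib] using this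
  refine tendsto_nhds_unique hlhs ?_
  have hrhs : Tendsto (fun s : Finset ℤ => ∫ t in (0 : ℝ)..x, ∑ n ∈ s, (2 * Real.pi * n) ^ 4 *
        (cosCoeff n (Z t) * cosCoeff n (V t) + cosCoeff n (V t) * cosCoeff n (Z t) +
          (sinCoeff n (Z t) * sinCoeff n (V t) + sinCoeff n (V t) * sinCoeff n (Z t)))) atTop
      (𝓝 (∫ t in (0 : ℝ)..x, 2 * ∫ y in (0 : ℝ)..1, Q t y * Z t y)) := by
    refine intervalIntegral.tendsto_integral_filter_of_dominated_convergence
      (fun t => (∫ y in (0 : ℝ)..1, Q t y ^ 2) + ∫ y in (0 : ℝ)..1, Z t y ^ 2)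
      (Eventually.of_forall fun s => ?_) (Eventually.of_forall fun s => ?_) ?_ ?_
    · have := ((hfin s).1.mono_set (uIcc_subset_uIcc left_mem_uIcc hx')).def'
      exact this.aestronglyMeasurable
    · filter_upwards [hres (hderiv s), hres hZs, hres hQs] with t h1 h2 h3 htx
      rw [h1 htx, Real.norm_eq_abs]
      exact abs_sum_mul_coeff_le (h3 htx) (h2 htx) s
    · exact ((intervalIntegrable_iff_restrict_Icc hT).2 hbi).mono_set
        (uIcc_subset_uIcc left_mem_uIcc hx')
    · filter_upwards [hres (ae_all_iff.2 hderiv), hres hZs, hres hQs] with t h1 h2 h3 htx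
      simp only [h1 htx]
      have := (hasSum_mul_coeff (h3 htx) (h2 htx)).mul_left 2
      simpa only [HasSum, SummationFilter.unconditional_filter] using this
  refine hrhs.congr fun s => ?_
  exact ((hfin s).2 x hx').symm

/-- Poincaré's inequality `‖V_hh‖ ≤ ‖V_hhhh‖` over the period: the weights `(2πn)⁴` are either
`0` or at least `1`. -/
lemma energy_le_integral_sq {V Q : ℝ → ℝ} {E : ℝ} (hQ : MemLp Q 2 cell)
    (hE : HasSum (fun n : ℤ => (2 * Real.pi * n) ^ 4 * (cosCoeff n V ^ 2 + sinCoeff n V ^ 2)) E)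
    (hQV : ∀ n : ℤ, cosCoeff n Q = (2 * Real.pi * n) ^ 4 * cosCoeff n V ∧
      sinCoeff n Q = (2 * Real.pi * n) ^ 4 * sinCoeff n V) :
    E ≤ ∫ y in (0 : ℝ)..1, Q y ^ 2 := by
  refine hasSum_le (fun n => ?_) hE (hasSum_sq_coeff hQ)
  rw [(hQV n).1, (hQV n).2]
  have h1 : (2 * Real.pi * n) ^ 4 ≤ ((2 * Real.pi * n) ^ 4) ^ 2 := by
    rcases eq_or_ne n 0 with rfl | hn
    · simp
    · have h2 : (1 : ℝ) ≤ |2 * Real.pi * n| := by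
        rw [abs_mul, abs_of_pos Real.two_pi_pos]
        have h3 : (1 : ℝ) ≤ |(n : ℝ)| := by exact_mod_cast Int.one_le_abs hn
        nlinarith [Real.pi_gt_three]
      have h4 : 1 ≤ (2 * Real.pi * n) ^ 4 := by
        rw [← (show Even 4 by decide).pow_abs]
        exact one_le_pow₀ h2
      nlinarith
  nlinarith [sq_nonneg (cosCoeff n V), sq_nonneg (sinCoeff n V)]

/-- Grönwall's inequality for an absolutely continuous function. -/
lemma IsPrimOn.le_mul_exp {T β : ℝ} (hT : 0 ≤ T) {E D : ℝ → ℝ} (h : IsPrimOn 0 T E D)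
    (hD : ∀ᵐ t ∂volume.restrict (Icc 0 T), D t ≤ -β * E t) :
    E T ≤ E 0 * Real.exp (-β * T) := by
  have he : IsPrimOn 0 T (fun t => Real.exp (β * t)) (fun t => β * Real.exp (β * t)) :=
    IsPrimOn.of_hasDerivAt (fun t => by
      have := ((hasDerivAt_id' t).const_mul β).exp
      rwa [mul_one, mul_comm] at this) (by fun_prop)
  have h1 := (he.mul h).2 T right_mem_uIcc
  have h2 : ∫ t in (0 : ℝ)..T, (β * Real.exp (β * t) * E t + Real.exp (β * t) * D t) ≤ 0 := by
    rw [intervalIntegral.integral_of_le hT, ← integral_Icc_eq_integral_Ioc]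
    refine integral_nonpos_of_ae ?_
    filter_upwards [hD] with t ht
    have := mul_le_mul_of_nonneg_left ht (Real.exp_pos (β * t)).le
    simp only [Pi.zero_apply]
    linarith
  rw [← h1] at h2
  simp only [mul_zero, Real.exp_zero, one_mul] at h2
  rw [neg_mul, Real.exp_neg, ← div_eq_mul_inv, le_div_iff₀ (Real.exp_pos _)]
  linarith

/-! ### Regularity of solutions in space-time -/

/-- The Sobolev embedding of `H¹` into the continuous functions on the period cell. -/
lemma enorm_le_eLpNorm_add {d d₁ : ℝ → ℝ} (h : IsPrim d d₁) (hd : Continuous d₁) {x : ℝ}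
    (hx : x ∈ Icc (0 : ℝ) 1) : ‖d x‖ₑ ≤ eLpNorm d 2 cell + eLpNorm d₁ 2 cell := by
  have h1 : ∀ {k : ℝ → ℝ}, Continuous k →
      ENNReal.ofReal (∫ y in (0 : ℝ)..1, |k y|) ≤ eLpNorm k 2 cell := by
    intro k hk
    have hki : Integrable k cell := (memLp_cell_of_continuous hk).integrable (by norm_num)
    rw [← integral_cell]
    refine (ofReal_integral_norm_eq_lintegral_enorm hki).le.trans ?_
    rw [← eLpNorm_one_eq_lintegral_enorm]
    exact eLpNorm_le_eLpNorm_of_exponent_le (by norm_num) hk.aestronglyMeasurable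
  have hdi : ∀ a b : ℝ, IntervalIntegrable (fun y => |d y|) volume a b := fun a b =>
    h.continuous.abs.intervalIntegrable _ _
  have h2 : |d x| ≤ (∫ y in (0 : ℝ)..1, |d y|) + ∫ y in (0 : ℝ)..1, |d₁ y| := by
    have h3 : ∫ y in (0 : ℝ)..1, |d x| ≤
        ∫ y in (0 : ℝ)..1, (|d y| + ∫ z in (0 : ℝ)..1, |d₁ z|) := by
      refine intervalIntegral.integral_mono_on zero_le_one (by simp)
        ((hdi 0 1).add (by simp)) fun y hy => ?_
      have h4 := abs_intervalIntegral_le_cell (hd.intervalIntegrable _ _) hy hx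
      rw [h.integral_eq y x] at h4
      linarith [abs_sub_abs_le_abs_sub (d x) (d y)]
    rw [intervalIntegral.integral_add (hdi 0 1) (by simp)] at h3
    simpa using h3
  rw [Real.enorm_eq_ofReal_abs]
  refine (ENNReal.ofReal_le_ofReal h2).trans (ENNReal.ofReal_add_le.trans ?_)
  exact add_le_add (h1 h.continuous) (h1 hd)

/-- The uniform distance of two periodic profiles is controlled by the Sobolev norm of the
difference; periodicity extends the bound from the cell to the line. -/
lemma enorm_sub_sq_le_sobolevNormSq {f g : ℝ → ℝ} (hf : MemHper 2 f) (hg : MemHper 2 g)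
    (hfc : Continuous f) (hgc : Continuous g) (x : ℝ) :
    ‖f x - g x‖ₑ ^ 2 ≤ 4 * sobolevNormSq 2 (fun h => f h - g h) := by
  obtain ⟨f₁, -, hf1, hf1c, -⟩ := hf.exists_primitives hfc
  obtain ⟨g₁, -, hg1, hg1c, -⟩ := hg.exists_primitives hgc
  have hp : IsPrim (fun h => f h - g h) (fun h => f₁ h - g₁ h) := by
    have := hf1.add fun a b => (hg1 a b).const_mul (-1)
    simpa only [neg_one_mul, ← sub_eq_add_neg] using this
  have hd : Continuous fun h => f₁ h - g₁ h := hf1c.sub hg1c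
  have hper : Function.Periodic (fun h => f h - g h) 1 := fun y => by
    simp only [hf.periodic hfc y, hg.periodic hgc y]
  obtain ⟨y, hy, hxy⟩ := hper.exists_mem_Ico₀ one_pos x
  rw [hxy]
  have h1 := enorm_le_eLpNorm_add hp hd (Ico_subset_Icc_self hy)
  have e0 : eLpNorm (fun h => f h - g h) 2 cell =
      eLpNorm (weakDeriv 0 fun h => f h - g h) 2 cell :=
    eLpNorm_congr_ae (ae_restrict_of_ae
      (isWeakDeriv_zero hp.continuous.locallyIntegrable).weakDeriv_ae_eq.symm)
  have e1 : eLpNorm (fun h => f₁ h - g₁ h) 2 cell =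
      eLpNorm (weakDeriv 1 fun h => f h - g h) 2 cell :=
    eLpNorm_congr_ae (ae_restrict_of_ae hp.isWeakDeriv_one.weakDeriv_ae_eq.symm)
  rw [e0, e1] at h1
  set A := eLpNorm (weakDeriv 0 fun h => f h - g h) 2 cell
  set B := eLpNorm (weakDeriv 1 fun h => f h - g h) 2 cell
  have h2 : max A B ^ 2 ≤ sobolevNormSq 2 (fun h => f h - g h) := by
    unfold sobolevNormSq
    rw [Finset.sum_range_succ, Finset.sum_range_succ, Finset.sum_range_one]
    rcases max_choice A B with h | h <;> rw [h]
    · exact le_add_right (le_add_right le_rfl)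
    · exact le_add_right (le_add_left le_rfl)
  calc _ ≤ (A + B) ^ 2 := by gcongr
    _ ≤ (2 * max A B) ^ 2 := by
        gcongr
        rw [two_mul]
        exact add_le_add (le_max_left _ _) (le_max_right _ _)
    _ = 4 * max A B ^ 2 := by rw [mul_pow]; norm_num
    _ ≤ _ := by gcongr

/-- Projection of the time axis onto `[0, T]`, used to extend solutions to all times. -/
def clampTime (T t : ℝ) : ℝ := max 0 (min T t)

lemma clampTime_mem {T : ℝ} (hT : 0 ≤ T) (t : ℝ) : clampTime T t ∈ Icc 0 T :=
  ⟨le_max_left _ _, max_le hT (min_le_left _ _)⟩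

lemma clampTime_eq {T t : ℝ} (ht : t ∈ Icc 0 T) : clampTime T t = t := by
  rw [clampTime, min_eq_right ht.2, max_eq_right ht.1]

lemma continuous_clampTime (T : ℝ) : Continuous (clampTime T) := by
  unfold clampTime; fun_prop

lemma IsStrongSolution.continuous_clamp {T : ℝ} {u₀ : ℝ → ℝ} {u : ℝ → ℝ → ℝ} (hT : 0 ≤ T)
    (h : IsStrongSolution T u₀ u) : Continuous fun p : ℝ × ℝ => u (clampTime T p.1) p.2 := by
  refine continuous_iff_continuousAt.2 fun ⟨t₀, h₀⟩ => ?_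
  have hm := clampTime_mem hT
  refine tendsto_comp_of_locally_uniform_limit (f := u (clampTime T t₀))
    (F := fun p : ℝ × ℝ => u (clampTime T p.1)) (g := fun p : ℝ × ℝ => p.2)
    (h.continuous_profile _ (hm t₀)).continuousAt continuous_snd.continuousAt fun s hs => ?_
  refine ⟨univ, univ_mem, ?_⟩
  obtain ⟨ε, hε, hεs⟩ := Metric.mem_uniformity_dist.1 hs
  have h1 : Tendsto (clampTime T) (𝓝 t₀) (𝓝[Icc 0 T] (clampTime T t₀)) :=
    tendsto_nhdsWithin_iff.2 ⟨(continuous_clampTime T).continuousAt, Eventually.of_forall hm⟩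
  have h2 := (h.continuous_H2 _ (hm t₀)).comp h1
  have h3 := ENNReal.Tendsto.const_mul (a := 4) h2 (Or.inr (by norm_num))
  rw [mul_zero] at h3
  have h4 : ∀ᶠ t in 𝓝 t₀, 4 * sobolevNormSq 2
      (fun y => u (clampTime T t) y - u (clampTime T t₀) y) < ENNReal.ofReal ε ^ 2 :=
    h3.eventually_lt_const (by positivity)
  filter_upwards [continuous_fst.continuousAt.eventually h4] with p hp y _
  refine hεs ?_
  have h5 := (enorm_sub_sq_le_sobolevNormSq (h.mem_H2 _ (hm p.1)) (h.mem_H2 _ (hm t₀))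
    (h.continuous_profile _ (hm p.1)) (h.continuous_profile _ (hm t₀)) y).trans_lt hp
  have h6 := lt_of_not_ge fun h => h5.not_ge (pow_le_pow_left' h 2)
  rw [Real.enorm_eq_ofReal_abs, ENNReal.ofReal_lt_ofReal_iff hε] at h6
  rwa [dist_comm, Real.dist_eq]

/-- Testing the weak time derivative with products `χ(t) ψ(h)`: weighted averages over the period
are absolutely continuous in time. -/
lemma weighted_average_sub {T : ℝ} (hT : 0 < T) {U w : ℝ → ℝ → ℝ}
    (hU : Continuous fun p : ℝ × ℝ => U p.1 p.2)
    (hw : Integrable (fun p : ℝ × ℝ => w p.1 p.2) (rect T))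
    (hweak : IsWeakTimeDeriv T U w) {ψ : ℝ → ℝ} (hψ : ContDiff ℝ ∞ ψ) (hψc : HasCompactSupport ψ)
    (hψs : tsupport ψ ⊆ Ioo 0 1) {t : ℝ} (ht : t ∈ Icc 0 T) :
    (∫ y, U t y * ψ y ∂cell) - ∫ y, U 0 y * ψ y ∂cell =
      ∫ s in (0 : ℝ)..t, ∫ y, w s y * ψ y ∂cell := by
  have hψz : ∀ y, y ∉ Icc (0 : ℝ) 1 → ψ y = 0 := fun y hy =>
    image_eq_zero_of_notMem_tsupport fun h => hy (Ioo_subset_Icc_self (hψs h))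
  have hwψ : Integrable (fun p : ℝ × ℝ => w p.1 p.2 * ψ p.2) (rect T) :=
    integrable_rect_mul_continuous hw (f := fun p => ψ p.2)
      (hψ.continuous.comp continuous_snd)
  have hB : Integrable (fun s => ∫ y, w s y * ψ y ∂cell) (volume.restrict (Icc 0 T)) :=
    hwψ.integral_prod_left
  have hA : Continuous fun s => ∫ y, U s y * ψ y ∂cell := by
    simp only [integral_cell]
    exact intervalIntegral.continuous_parametric_intervalIntegral_of_continuous'
      (f := fun s y => U s y * ψ y) (hU.mul (hψ.continuous.comp continuous_snd)) 0 1
  have hmid : T / 2 ∈ Ioo 0 T := ⟨by linarith, by linarith⟩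
  have hBi : IntervalIntegrable (fun s => ∫ y, w s y * ψ y ∂cell) volume 0 T :=
    (intervalIntegrable_iff_restrict_Icc hT.le).2 hB
  obtain ⟨C, hC⟩ := ae_eq_const_add_integral hmid
    (hA.integrableOn_Icc.mono_set Ioo_subset_Icc_self)
    (IntegrableOn.mono_set (s := Ioo 0 T) (t := Icc 0 T) hB Ioo_subset_Icc_self)
    fun χ hχ hχc hχs => by
      have hχz : ∀ s, s ∉ Icc 0 T → χ s = 0 := fun s hs =>
        image_eq_zero_of_notMem_tsupport fun h => hs (Ioo_subset_Icc_self (hχs h))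
      have hχz' : ∀ s, s ∉ Icc 0 T → deriv χ s = 0 := fun s hs =>
        image_eq_zero_of_notMem_tsupport fun h =>
          hs (Ioo_subset_Icc_self (hχs (tsupport_deriv_subset (𝕜 := ℝ) h)))
      have hd : Continuous (deriv χ) := hχ.continuous_deriv (by norm_num)
      have hts : tsupport (fun p : ℝ × ℝ => χ p.1 * ψ p.2) ⊆ tsupport χ ×ˢ tsupport ψ := by
        refine closure_minimal (fun p hp => ?_) ((isClosed_tsupport _).prod (isClosed_tsupport _))
        exact ⟨subset_closure (left_ne_zero_of_mul hp), subset_closure (right_ne_zero_of_mul hp)⟩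
      have h1 := hweak (fun p => χ p.1 * ψ p.2)
        ((hχ.comp contDiff_fst).mul (hψ.comp contDiff_snd))
        ((hχc.isCompact.prod hψc.isCompact).of_isClosed_subset (isClosed_tsupport _) hts)
        (hts.trans (prod_mono hχs (subset_univ _)))
      have hder : ∀ p : ℝ × ℝ, deriv (fun s => χ s * ψ p.2) p.1 = deriv χ p.1 * ψ p.2 := fun p =>
        deriv_mul_const (hχ.differentiable (by norm_num) p.1) _
      simp only [hder] at h1
      have hrect : ∀ {k : ℝ × ℝ → ℝ}, (∀ p, p ∉ Icc (0 : ℝ) T ×ˢ Icc (0 : ℝ) 1 → k p = 0) →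
          ∫ p, k p = ∫ p, k p ∂rect T := fun hk => by
        rw [rect_eq, setIntegral_eq_integral_of_forall_compl_eq_zero hk]
      have hline : ∀ {k : ℝ → ℝ}, (∀ s, s ∉ Icc 0 T → k s = 0) →
          ∫ s, k s = ∫ s in Icc 0 T, k s := fun hk =>
        (setIntegral_eq_integral_of_forall_compl_eq_zero hk).symm
      rw [hrect fun p hp => ?_, hrect fun p hp => ?_, rect, integral_prod, integral_prod] at h1
      · rw [hline fun s hs => by rw [hχz' s hs, mul_zero], hline fun s hs => by
          rw [hχz s hs, mul_zero]]
        simp only [← integral_mul_const]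
        have e : ∀ a b c : ℝ, a * b * c = a * (c * b) := fun a b c => by ring
        simpa only [e] using h1
      · exact integrable_rect_mul_continuous hw (f := fun p => χ p.1 * ψ p.2)
          ((hχ.continuous.comp continuous_fst).mul (hψ.continuous.comp continuous_snd))
      · have hone : Integrable (fun _ : ℝ × ℝ => (1 : ℝ)) (rect T) := integrable_const _
        have := integrable_rect_mul_continuous hone
          (f := fun p => U p.1 p.2 * (deriv χ p.1 * ψ p.2)) (hU.mul
            ((hd.comp continuous_fst).mul (hψ.continuous.comp continuous_snd)))
        simpa only [one_mul, rect] using this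
      · by_cases h1 : p.1 ∈ Icc 0 T
        · rw [hψz p.2 fun h2 => hp ⟨h1, h2⟩, mul_zero, mul_zero]
        · rw [hχz p.1 h1, zero_mul, mul_zero]
      · by_cases h1 : p.1 ∈ Icc 0 T
        · rw [hψz p.2 fun h2 => hp ⟨h1, h2⟩, mul_zero, mul_zero]
        · rw [hχz' p.1 h1, zero_mul, mul_zero]
  -- both sides are continuous up to the endpoints, so equality holds on all of `[0, T]`
  have hii : ∀ {a b : ℝ}, a ∈ Icc 0 T → b ∈ Icc 0 T →
      IntervalIntegrable (fun s => ∫ y, w s y * ψ y ∂cell) volume a b := by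
    intro a b ha hb
    refine hBi.mono_set ?_
    rw [uIcc_of_le hT.le]
    exact OrdConnected.uIcc_subset ordConnected_Icc ha hb
  have hG : ContinuousOn (fun x => C + ∫ s in (T / 2)..x, ∫ y, w s y * ψ y ∂cell) (Icc 0 T) := by
    have := intervalIntegral.continuousOn_primitive_interval' (b₁ := 0) (b₂ := T) (a := T / 2)
      hBi (by rw [uIcc_of_le hT.le]; exact Ioo_subset_Icc_self hmid)
    rw [uIcc_of_le hT.le] at this
    exact continuousOn_const.add this
  have heq : EqOn (fun s => ∫ y, U s y * ψ y ∂cell)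
      (fun x => C + ∫ s in (T / 2)..x, ∫ y, w s y * ψ y ∂cell) (Icc 0 T) := by
    have h1 : EqOn (fun s => ∫ y, U s y * ψ y ∂cell)
        (fun x => C + ∫ s in (T / 2)..x, ∫ y, w s y * ψ y ∂cell) (Ioo 0 T) :=
      MeasureTheory.Measure.eqOn_open_of_ae_eq (μ := volume)
        ((ae_restrict_iff' measurableSet_Ioo).2 hC) isOpen_Ioo hA.continuousOn
        (hG.mono Ioo_subset_Icc_self)
    have h2 := h1.of_subset_closure hA.continuousOn hG Ioo_subset_Icc_self
      (by rw [closure_Ioo hT.ne])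
    exact h2
  have h0 : (0 : ℝ) ∈ Icc 0 T := ⟨le_rfl, hT.le⟩
  have e1 := heq ht
  have e2 := heq h0
  simp only at e1 e2
  rw [e1, e2, ← intervalIntegral.integral_interval_sub_left
    (hii (Ioo_subset_Icc_self hmid) ht) (hii (Ioo_subset_Icc_self hmid) h0)]
  ring

/-- For almost every `h`, the solution is absolutely continuous in time with derivative `w`. -/
lemma ae_isPrimOn_time {T : ℝ} (hT : 0 < T) {U w : ℝ → ℝ → ℝ}
    (hU : Continuous fun p : ℝ × ℝ => U p.1 p.2)
    (hw : Integrable (fun p : ℝ × ℝ => w p.1 p.2) (rect T)) (hweak : IsWeakTimeDeriv T U w) :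
    ∀ᵐ y ∂cell, IsPrimOn 0 T (fun t => U t y) (fun t => w t y) := by
  have hfix : ∀ t ∈ Icc 0 T, ∀ᵐ y ∂cell, U t y - U 0 y = ∫ s in (0 : ℝ)..t, w s y := by
    intro t ht
    have hsub : Integrable (fun p : ℝ × ℝ => w p.1 p.2) ((volume.restrict (Ioc 0 t)).prod cell) := by
      refine hw.mono_measure (Measure.prod_mono (Measure.restrict_mono ?_ le_rfl) le_rfl)
      exact Ioc_subset_Icc_self.trans (Icc_subset_Icc_right ht.2)
    have hIi : Integrable (fun y => ∫ s in (0 : ℝ)..t, w s y) cell := by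
      simp only [intervalIntegral.integral_of_le ht.1]
      exact hsub.integral_prod_right
    have hUc : ∀ s, Integrable (U s) cell := fun s =>
      (memLp_cell_of_continuous (f := U s) (by fun_prop)).integrable (by norm_num)
    have hFi : Integrable (fun y => U t y - U 0 y - ∫ s in (0 : ℝ)..t, w s y) cell :=
      ((hUc t).sub (hUc 0)).sub hIi
    have h1 : ∀ᵐ y, y ∈ Ioo (0 : ℝ) 1 → U t y - U 0 y - ∫ s in (0 : ℝ)..t, w s y = 0 := by
      refine isOpen_Ioo.ae_eq_zero_of_integral_contDiff_smul_eq_zero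
        (f := fun y => U t y - U 0 y - ∫ s in (0 : ℝ)..t, w s y) ?_ fun ψ hψ hψc hψs => ?_
      · exact (IntegrableOn.mono_set (t := Icc 0 1) hFi Ioo_subset_Icc_self).locallyIntegrableOn
      · have h2 := weighted_average_sub hT hU hw hweak hψ hψc hψs ht
        obtain ⟨M, hM⟩ := hψ.continuous.bounded_above_of_compact_support hψc
        have hb : ∀ {k : ℝ → ℝ}, Integrable k cell → Integrable (fun y => k y * ψ y) cell :=
          fun hk => hk.mul_bdd hψ.continuous.aestronglyMeasurable (Eventually.of_forall hM)
        have h3 : Integrable (fun p : ℝ × ℝ => w p.1 p.2 * ψ p.2)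
            ((volume.restrict (Ioc 0 t)).prod cell) :=
          hsub.mul_bdd (hψ.continuous.comp continuous_snd).aestronglyMeasurable
            (Eventually.of_forall fun p => hM p.2)
        rw [intervalIntegral.integral_of_le ht.1, integral_integral_swap h3] at h2
        have h4 : ∫ y, ψ y • (U t y - U 0 y - ∫ s in (0 : ℝ)..t, w s y) =
            ∫ y, (U t y * ψ y - U 0 y * ψ y - (∫ s in (0 : ℝ)..t, w s y) * ψ y) ∂cell := by
          rw [cell, setIntegral_eq_integral_of_forall_compl_eq_zero fun y hy => ?_]
          · congr 1; ext y; rw [smul_eq_mul]; ring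
          · rw [image_eq_zero_of_notMem_tsupport fun h => hy (Ioo_subset_Icc_self (hψs h))]
            ring
        have h6 : Integrable (fun y => U t y * ψ y - U 0 y * ψ y) cell :=
          (hb (hUc t)).sub (hb (hUc 0))
        rw [h4, integral_sub h6 (hb hIi),
          integral_sub (hb (hUc t)) (hb (hUc 0)), h2, sub_eq_zero]
        simp only [intervalIntegral.integral_of_le ht.1, integral_mul_const]
    have h5 : cell = volume.restrict (Ioo (0 : ℝ) 1) :=
      Measure.restrict_congr_set Ioo_ae_eq_Icc.symm
    rw [h5]
    filter_upwards [(ae_restrict_iff' measurableSet_Ioo).2 h1] with y hy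
    exact sub_eq_zero.1 hy
  -- countably many times suffice, both sides being continuous in time
  have hrat : ∀ᵐ y ∂cell, ∀ q : ℚ, U (clampTime T q) y - U 0 y =
      ∫ s in (0 : ℝ)..clampTime T q, w s y :=
    ae_all_iff.2 fun q => hfix _ (clampTime_mem hT.le q)
  filter_upwards [hrat, hw.prod_left_ae] with y hy hwy
  have hwi : IntervalIntegrable (fun s => w s y) volume 0 T :=
    (intervalIntegrable_iff_restrict_Icc hT.le).2 hwy
  refine ⟨hwi, fun t ht => ?_⟩
  rw [uIcc_of_le hT.le] at ht
  have hprim : Continuous fun t => ∫ s in (0 : ℝ)..clampTime T t, w s y := by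
    have := intervalIntegral.continuousOn_primitive_interval' hwi left_mem_uIcc
    rw [uIcc_of_le hT.le] at this
    exact this.comp_continuous (continuous_clampTime T) (clampTime_mem hT.le)
  have hUc : Continuous fun t => U (clampTime T t) y - U 0 y := by
    have := continuous_clampTime T
    fun_prop
  have := congrFun (Rat.isDenseEmbedding_coe_real.dense.equalizer hUc hprim (funext hy)) t
  simpa only [clampTime_eq ht] using this

/-! ### Conservation law and energy decay for strong solutions -/

lemma IsWeakTimeDeriv.clamp {T : ℝ} {u w : ℝ → ℝ → ℝ} (h : IsWeakTimeDeriv T u w) :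
    IsWeakTimeDeriv T (fun t => u (clampTime T t)) w := by
  intro φ hφ hc hs
  rw [← h φ hφ hc hs]
  congr 1
  ext p
  by_cases hp : p.1 ∈ Icc 0 T
  · simp only [clampTime_eq hp]
  · have h1 : φ =ᶠ[𝓝 p] 0 :=
      notMem_tsupport_iff_eventuallyEq.1 fun hm => hp (Ioo_subset_Icc_self (hs hm).1)
    have h2 : Tendsto (fun s : ℝ => (s, p.2)) (𝓝 p.1) (𝓝 p) :=
      (Continuous.prodMk_left p.2).tendsto p.1
    have h3 : (fun s => φ (s, p.2)) =ᶠ[𝓝 p.1] fun _ => 0 := h2.eventually h1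
    simp only [h3.deriv_eq, deriv_const, mul_zero]

lemma isPrimOn_inv {T : ℝ} {f g : ℝ → ℝ} (hpos : ∀ t, 0 < f t) (h : IsPrimOn 0 T f g) :
    IsPrimOn 0 T (fun t => (f t)⁻¹) (fun t => -(f t ^ 2)⁻¹ * g t) := by
  obtain ⟨a, -, hmin⟩ := isCompact_uIcc.exists_isMinOn nonempty_uIcc h.continuousOn
  obtain ⟨b, -, hmax⟩ := isCompact_uIcc.exists_isMaxOn nonempty_uIcc h.continuousOn
  have hne : ∀ y ∈ Icc (f a) (f b), y ≠ 0 := fun y hy => ((hpos a).trans_le hy.1).ne'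
  refine h.comp (c := f a) (d := f b) (φ := fun y => y⁻¹) (φ' := fun y => -(y ^ 2)⁻¹)
    (fun y hy => hasDerivAt_inv (hne y hy)) ?_ fun x hx => ⟨hmin hx, hmax hx⟩
  exact ((continuousOn_id.pow 2).inv₀ fun y hy => pow_ne_zero 2 (hne y hy)).neg

lemma isPrimOn_cubic {T : ℝ} {f g : ℝ → ℝ} (h : IsPrimOn 0 T f g) :
    IsPrimOn 0 T (fun t => f t ^ 3 + f t) (fun t => (3 * f t ^ 2 + 1) * g t) := by
  obtain ⟨M, hM⟩ := isCompact_uIcc.exists_bound_of_continuousOn h.continuousOn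
  exact h.comp (c := -M) (d := M) (φ := fun y => y ^ 3 + y) (φ' := fun y => 3 * y ^ 2 + 1)
    (fun y _ => hasDerivAt_cubic y) (by fun_prop) fun x hx => abs_le.1 (hM x hx)

/-- The two integrated laws of a strong solution: `∫ 1/u` is conserved because
`(1/u)_t = (u³ + u)_hhhh` has mean zero, and the energy dissipates at a rate governed by any lower
bound `b` of `u`, because `2 (u³ + u)_t (u³ + u)_hhhh = -2u²(3u² + 1) (u³ + u)_hhhh²`. -/
lemma IsStrongSolution.conservation_and_decay {T : ℝ} {u₀ : ℝ → ℝ} {u : ℝ → ℝ → ℝ} (hT : 0 < T)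
    (h : IsStrongSolution T u₀ u) {b : ℝ} (hb0 : 0 ≤ b)
    (hb : ∀ t ∈ Icc 0 T, ∀ y ∈ Icc (0 : ℝ) 1, b ≤ u t y) :
    ∫ y in (0 : ℝ)..1, (u T y)⁻¹ = ∫ y in (0 : ℝ)..1, (u 0 y)⁻¹ ∧
      energy (u T) ≤ energy (u 0) * Real.exp (-(2 * b ^ 2 + 6 * b ^ 4) * T) := by
  obtain ⟨w, -, -, hw, hweak, heq⟩ := h.equation
  rw [← rect_eq] at hw
  set U : ℝ → ℝ → ℝ := fun t => u (clampTime T t) with hUdef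
  have hm := clampTime_mem hT.le
  have hUe : ∀ t ∈ Icc 0 T, U t = u t := fun t ht => by rw [hUdef]; simp only [clampTime_eq ht]
  have hU : Continuous fun p : ℝ × ℝ => U p.1 p.2 := h.continuous_clamp hT.le
  have hpos : ∀ t y, 0 < U t y := fun t y => h.pos _ (hm t) y
  have hwi : Integrable (fun p : ℝ × ℝ => w p.1 p.2) (rect T) := hw.integrable (by norm_num)
  have hAC := ae_isPrimOn_time hT hU hwi hweak.clamp
  -- `Q` is `(u³ + u)_hhhh`, expressed through the equation
  set Q : ℝ → ℝ → ℝ := fun t y => -(U t y ^ 2)⁻¹ * w t y with hQdef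
  have hQ : MemLp (fun p : ℝ × ℝ => Q p.1 p.2) 2 (rect T) :=
    memLp_rect_continuous_mul (f := fun p => -(U p.1 p.2 ^ 2)⁻¹)
      ((hU.pow 2).inv₀ fun p => (pow_pos (hpos _ _) 2).ne').neg hw
  have hQV : ∀ᵐ t ∂volume.restrict (Icc 0 T), ∀ n : ℤ,
      cosCoeff n (Q t) = (2 * Real.pi * n) ^ 4 * cosCoeff n (fun y => U t y ^ 3 + U t y) ∧
      sinCoeff n (Q t) = (2 * Real.pi * n) ^ 4 * sinCoeff n (fun y => U t y ^ 3 + U t y) := by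
    filter_upwards [heq, h.mem_H4, ae_restrict_mem measurableSet_Icc] with t ht h4 htm n
    have hQe : Q t =ᵐ[cell] weakDeriv 4 (fun x => u t x ^ 3 + u t x) := by
      refine ae_restrict_of_ae (ht.mono fun y hy => ?_)
      simp only [hQdef]
      rw [hUe t htm, hy]
      have := (h.pos t htm y).ne'
      field_simp
    rw [cosCoeff_congr hQe, sinCoeff_congr hQe, hUe t htm]
    exact h4.coeff_weakDeriv_four (h.continuous_profile t htm) n
  have h0 : (0 : ℝ) ∈ Icc 0 T := ⟨le_rfl, hT.le⟩
  have hTm : T ∈ Icc 0 T := ⟨hT.le, le_rfl⟩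
  constructor
  · have h1 : IsPrimOn 0 T (fun t => cosCoeff 0 (fun y => (U t y)⁻¹)) (fun t => cosCoeff 0 (Q t)) :=
      isPrimOn_integral hT.le (V := fun t y => (U t y)⁻¹) (hU.inv₀ fun p => (hpos _ _).ne')
        (hQ.integrable (by norm_num)) (continuous_cos_mode 0)
        (hAC.mono fun y hy => isPrimOn_inv (fun t => hpos t y) hy)
    have h2 := h1.2 T right_mem_uIcc
    have h3 : ∫ t in (0 : ℝ)..T, cosCoeff 0 (Q t) = 0 := by
      rw [intervalIntegral.integral_of_le hT.le, ← integral_Icc_eq_integral_Ioc]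
      refine integral_eq_zero_of_ae (hQV.mono fun t ht => ?_)
      change cosCoeff 0 (Q t) = 0
      rw [(ht 0).1]
      simp
    simp only at h2
    rw [h3, sub_eq_zero, hUe T hTm, hUe 0 h0] at h2
    simpa [cosCoeff] using h2
  · have hV : Continuous fun p : ℝ × ℝ => U p.1 p.2 ^ 3 + U p.1 p.2 := (hU.pow 3).add hU
    have hZ : MemLp (fun p : ℝ × ℝ => (3 * U p.1 p.2 ^ 2 + 1) * w p.1 p.2) 2 (rect T) :=
      memLp_rect_continuous_mul (f := fun p => 3 * U p.1 p.2 ^ 2 + 1) (by fun_prop) hw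
    have hE : ∀ t ∈ Icc 0 T, HasSum (fun n : ℤ => (2 * Real.pi * n) ^ 4 *
        (cosCoeff n (fun y => U t y ^ 3 + U t y) ^ 2 +
          sinCoeff n (fun y => U t y ^ 3 + U t y) ^ 2)) (energy (u t)) := fun t ht => by
      rw [hUe t ht]
      exact (h.mem_H2 t ht).hasSum_energy (h.continuous_profile t ht)
    have h1 := energy_identity hT.le (V := fun t y => U t y ^ 3 + U t y)
      (Z := fun t y => (3 * U t y ^ 2 + 1) * w t y) (E := fun t => energy (u t)) hV hZ hQ
      (hAC.mono fun y hy => isPrimOn_cubic hy) hE hQV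
    refine h1.le_mul_exp hT.le ?_
    filter_upwards [hQV, ae_memLp_slice hQ,
      ae_memLp_slice (Z := fun t y => (3 * U t y ^ 2 + 1) * w t y) hZ,
      ae_restrict_mem measurableSet_Icc] with t h2 h3 h4 htm
    have h5 := energy_le_integral_sq h3 (hE t htm) h2
    have h6 : ∫ y in (0 : ℝ)..1, 2 * (Q t y * ((3 * U t y ^ 2 + 1) * w t y)) ≤
        ∫ y in (0 : ℝ)..1, -(2 * b ^ 2 + 6 * b ^ 4) * Q t y ^ 2 := by
      refine intervalIntegral.integral_mono_on zero_le_one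
        (intervalIntegrable_iff_integrable_cell.2 ((h3.integrable_mul h4).const_mul 2))
        (intervalIntegrable_iff_integrable_cell.2 (h3.integrable_sq.const_mul _)) fun y hy => ?_
      have h7 : w t y = -(U t y ^ 2) * Q t y := by
        simp only [hQdef]
        have := (hpos t y).ne'
        field_simp
      have h8 : b ≤ U t y := by rw [hUe t htm]; exact hb t htm y hy
      have h9 : b ^ 2 ≤ U t y ^ 2 := pow_le_pow_left₀ hb0 h8 2
      have h10 : b ^ 4 ≤ U t y ^ 4 := pow_le_pow_left₀ hb0 h8 4
      rw [h7]
      nlinarith [mul_nonneg (sub_nonneg.2 h9) (sq_nonneg (Q t y)),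
        mul_nonneg (sub_nonneg.2 h10) (sq_nonneg (Q t y))]
    rw [intervalIntegral.integral_const_mul, intervalIntegral.integral_const_mul] at h6
    have h11 : 0 ≤ 2 * b ^ 2 + 6 * b ^ 4 := by positivity
    refine h6.trans ?_
    rw [neg_mul, neg_mul]
    exact neg_le_neg (mul_le_mul_of_nonneg_left h5 h11)

lemma IsGlobalStrongSolution.integral_inv_eq {u₀ : ℝ → ℝ} {u : ℝ → ℝ → ℝ}
    (h : IsGlobalStrongSolution u₀ u) {t : ℝ} (ht : 0 ≤ t) :
    ∫ y in (0 : ℝ)..1, (u t y)⁻¹ = ∫ y in (0 : ℝ)..1, (u 0 y)⁻¹ := by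
  rcases ht.eq_or_lt with rfl | ht
  · rfl
  · exact ((h t ht).conservation_and_decay ht le_rfl
      fun s hs y _ => ((h t ht).pos s hs y).le).1

lemma IsGlobalStrongSolution.energy_le {u₀ : ℝ → ℝ} {u : ℝ → ℝ → ℝ}
    (h : IsGlobalStrongSolution u₀ u) {b : ℝ} (hb0 : 0 ≤ b)
    (hb : ∀ t, 0 ≤ t → ∀ y ∈ Icc (0 : ℝ) 1, b ≤ u t y) {t : ℝ} (ht : 0 ≤ t) :
    energy (u t) ≤ energy u₀ * Real.exp (-(2 * b ^ 2 + 6 * b ^ 4) * t) := by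
  have he : energy u₀ = energy (u 0) := by
    have : (fun x => u 0 x ^ 3 + u 0 x) =ᵐ[volume] fun x => u₀ x ^ 3 + u₀ x :=
      (h 1 one_pos).initial.mono fun x hx => by simp only [hx]
    rw [energy, energy, weakDeriv_congr this]
  rw [he]
  rcases ht.eq_or_lt with rfl | ht
  · simp
  · exact ((h t ht).conservation_and_decay ht hb0 fun s hs y hy => hb s hs.1 y hy).2

end VicinalSurface

open VicinalSurface in
theorem theorem2 (u₀ : ℝ → ℝ) (L : ℝ)
    (hu₀ : VicinalSurface.MemHper 2 u₀)
    (hu₀_nonneg : ∀ᵐ h, 0 ≤ u₀ h)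
    (hL : ∫⁻ h in Icc (0 : ℝ) 1, (ENNReal.ofReal (u₀ h))⁻¹ = ENNReal.ofReal L) :
    ∃ m : ℝ, 0 < m ∧
      ∀ u : ℝ → ℝ → ℝ, VicinalSurface.IsGlobalStrongSolution u₀ u →
        m ≤ VicinalSurface.uMin u ∧
        0 < VicinalSurface.decayRate u ∧
        (∀ t : ℝ, 0 ≤ t →
          VicinalSurface.energy (u t) ≤
            VicinalSurface.energy u₀ * Real.exp (-(VicinalSurface.decayRate u) * t)) ∧
        Tendsto (fun t : ℝ => eLpNorm (fun h => u t h - 1 / L) ⊤ VicinalSurface.cell)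
          atTop (𝓝 0) := by
  -- `L > 0` holds only once a solution exists, so the constant is written to be positive in any case
  refine ⟨1 / (|L| + 1) * Real.exp (-(√(energy u₀) * |L|)), by positivity, fun u hu => ?_⟩
  have hmem : ∀ {t : ℝ}, 0 ≤ t →
      MemHper 2 (u t) ∧ Continuous (u t) ∧ ∀ y, 0 < u t y := fun {t} ht => by
    have hs := hu (t + 1) (by linarith)
    have htm : t ∈ Icc 0 (t + 1) := ⟨ht, by linarith⟩
    exact ⟨hs.mem_H2 t htm, hs.continuous_profile t htm, hs.pos t htm⟩
  obtain ⟨-, hc0, hp0⟩ := hmem le_rfl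
  have hci : Continuous fun y => (u 0 y)⁻¹ := hc0.inv₀ fun y => (hp0 y).ne'
  have hL0 : 0 < ∫ y in (0 : ℝ)..1, (u 0 y)⁻¹ :=
    intervalIntegral.intervalIntegral_pos_of_pos (hci.intervalIntegrable _ _)
      (fun y => inv_pos.2 (hp0 y)) one_pos
  have hL' : ∫ y in (0 : ℝ)..1, (u 0 y)⁻¹ = L := by
    have h1 : ∫⁻ h in Icc (0 : ℝ) 1, (ENNReal.ofReal (u₀ h))⁻¹ =
        ENNReal.ofReal (∫ y in (0 : ℝ)..1, (u 0 y)⁻¹) := by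
      rw [← integral_cell, ofReal_integral_eq_lintegral_ofReal
        ((memLp_cell_of_continuous hci).integrable (by norm_num))
        (Eventually.of_forall fun y => (inv_pos.2 (hp0 y)).le)]
      refine lintegral_congr_ae (ae_restrict_of_ae ((hu 1 one_pos).initial.mono fun y hy => ?_))
      simp only [← hy]
      rw [ENNReal.ofReal_inv_of_pos (hp0 y)]
    rw [h1] at hL
    have hLpos : 0 < L := by
      rw [← ENNReal.ofReal_pos, ← hL, ENNReal.ofReal_pos]
      exact hL0
    exact (ENNReal.ofReal_eq_ofReal_iff hL0.le hLpos.le).1 hL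
  have hLpos : 0 < L := hL' ▸ hL0
  have hcons : ∀ {t : ℝ}, 0 ≤ t → ∫ y in (0 : ℝ)..1, (u t y)⁻¹ = L := fun ht =>
    (hu.integral_inv_eq ht).trans hL'
  -- the energy is nonincreasing, which is the case `b = 0` of the decay estimate
  have hmono : ∀ {t : ℝ}, 0 ≤ t → energy (u t) ≤ energy u₀ := fun {t} ht => by
    have := hu.energy_le le_rfl (fun s hs y _ => ((hmem hs).2.2 y).le) ht
    simpa using this
  have hlow : ∀ t, 0 ≤ t → ∀ y ∈ Icc (0 : ℝ) 1,
      1 / (|L| + 1) * Real.exp (-(√(energy u₀) * |L|)) ≤ u t y := by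
    intro t ht y hy
    obtain ⟨h1, h2, h3⟩ := hmem ht
    refine le_trans ?_ (lower_bound h1 h2 h3 (hcons ht) hy)
    rw [abs_of_pos hLpos]
    have h4 : √(energy (u t)) ≤ √(energy u₀) := Real.sqrt_le_sqrt (hmono ht)
    gcongr
    linarith
  have hmin : 1 / (|L| + 1) * Real.exp (-(√(energy u₀) * |L|)) ≤ uMin u := by
    refine le_csInf ⟨_, mem_image_of_mem _ (mk_mem_prod self_mem_Ici
      (left_mem_Icc.2 zero_le_one))⟩ ?_
    rintro _ ⟨p, hp, rfl⟩
    exact hlow p.1 hp.1 p.2 hp.2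
  have hminpos : 0 < uMin u := lt_of_lt_of_le (by positivity) hmin
  have hrate : 0 < decayRate u := by unfold decayRate; positivity
  have hle : ∀ t, 0 ≤ t → ∀ y ∈ Icc (0 : ℝ) 1, uMin u ≤ u t y := by
    intro t ht y hy
    refine csInf_le ⟨0, ?_⟩ ⟨(t, y), ⟨ht, hy⟩, rfl⟩
    rintro _ ⟨p, hp, rfl⟩
    exact ((hmem hp.1).2.2 p.2).le
  have hdecay : ∀ t : ℝ, 0 ≤ t →
      energy (u t) ≤ energy u₀ * Real.exp (-(decayRate u) * t) := fun t ht =>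
    hu.energy_le hminpos.le hle ht
  refine ⟨hmin, hrate, hdecay, ?_⟩
  have hlim : Tendsto (fun t => ENNReal.ofReal √(energy u₀ * Real.exp (-(decayRate u) * t)))
      atTop (𝓝 0) := by
    have h1 : Tendsto (fun t => -(decayRate u) * t) atTop atBot :=
      tendsto_id.const_mul_atTop_of_neg (neg_neg_of_pos hrate)
    have h2 := ((Real.tendsto_exp_atBot.comp h1).const_mul (energy u₀)).sqrt
    rw [mul_zero, Real.sqrt_zero] at h2
    simpa using ENNReal.tendsto_ofReal h2
  refine tendsto_of_tendsto_of_tendsto_of_le_of_le' tendsto_const_nhds hlim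
    (Eventually.of_forall fun _ => zero_le) ?_
  filter_upwards [eventually_ge_atTop 0] with t ht
  obtain ⟨h1, h2, h3⟩ := hmem ht
  obtain ⟨y, hy, hyL⟩ := exists_eq_inv_integral h2 h3 (hcons ht)
  rw [eLpNorm_exponent_top]
  refine eLpNormEssSup_le_of_ae_bound ?_
  filter_upwards [ae_restrict_mem measurableSet_Icc] with x hx
  rw [← hyL]
  exact (abs_sub_le_sqrt_energy h1 h2 hx hy).trans (Real.sqrt_le_sqrt (hdecay t ht))
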